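/- **Theorem (transformer estimation error upper bound).** Let $d,r,L,K,T\ge 1$ be integers, and let $\Phi_1,\dots,\Phi_d\in\mathbb R^r$ be known vectors with $\|\Phi_j\|_2=1$. *Weights.* Let $\theta=(A^{(\ell)},V^{(\ell)})_{\ell=1}^L$ be independent random matrices, where $A^{(\ell)}\in\mathbb R^{r\times r}$ has iid $\mathcal N(0,1)$ entries, $V^{(\ell)}\in\mathbb R^{r\times r}$ for $\ell<L$, $V^{(L)}\in\mathbb R^{d\times r}$, and the rows of each $V^{(\ell)}$ are iid uniform on the Euclidean unit sphere $\mathbb S^{r-1}$ of $\mathbb R^r$. *Network.* For a matrix $U$ with $r$ rows put $$f_\ell(U)=\mathrm{Clip}\Big(V^{(\ell)}\,U\;\mathrm{Softmax}\big(U^\top A^{(\ell)}U/\sqrt r\big)\Big),$$ where Softmax acts on each column separately and Clip replaces each column $u$ by $u/\max\{1,\|u\|_2\}$. *Data.* Let $X_0,X_1,X_2,\dots$ be random tokens in $\{1,\dots,d\}$, with history $H_t=(X_0,\dots,X_t)$. The first token $X_0$ has an arbitrary distribution and is independent of $\theta$. For every $t\ge 0$, let $U_t^{(0)}$ be the matrix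 with columns $\Phi_{X_s}$, $\max\{0,t-K+1\}\le s\le t$, in this order (the embeddings of the last $K$ tokens, or of all tokens so far if there are fewer than $K$), and let $U_t^{(\ell)}=f_\ell(U_t^{(\ell-1)})$ for $1\le\ell\le L$. Conditionally on $(\theta,H_t)$, the next token $X_{t+1}$ is drawn from the softmax of the right-most column of $U_t^{(L)}$. *Error.* Let $\hat P_t(x)=\mathbb P(X_{t+1}=x\mid H_t)$ be the Bayesian posterior predictive distribution, and let $$\mathcal L_T=\frac1T\sum_{t=0}^{T-1}\mathbb E\big[-\ln\hat P_t(X_{t+1})\big]-\frac1T\sum_{t=0}^{T-1}\mathbb H(X_{t+1}\mid\theta,H_t)$$ be the optimal estimation error, where $\mathbb H(\cdot\mid\cdot)$ is conditional Shannon entropy in nats (by the chain rule the last sum is $\mathbb H(X_{1:T}\mid\theta,X_0)$). Then $$\mathcal L_T\ \le\ \frac{r\max\{r,d\}\,L^2\,\ln\!\big(8eK(1+16K)\big)}{T}+\frac{r\max\{r,d\}\,L\,\ln\!\big(2KT^2/L\big)}{T}.$$ -/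

import Mathlib

open MeasureTheory ProbabilityTheory
open scoped Matrix

noncomputable section

namespace TransformerProcess

/-! ### The network -/

/-- The softmax of a finite real vector. -/
def softmax {ι : Type*} [Fintype ι] (v : ι → ℝ) (i : ι) : ℝ :=
  Real.exp (v i) / ∑ j, Real.exp (v j)

/-- Softmax applied to every column of a matrix. -/
def colSoftmax {m n : ℕ} (M : Matrix (Fin m) (Fin n) ℝ) : Matrix (Fin m) (Fin n) ℝ :=
  Matrix.of fun i j => softmax (fun i' => M i' j) i

/-- Clipping: every column is projected to the closed Euclidean unit ball, that is, a column `u`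
becomes `u / max 1 ‖u‖₂`. -/
def clip {m n : ℕ} (M : Matrix (Fin m) (Fin n) ℝ) : Matrix (Fin m) (Fin n) ℝ :=
  Matrix.of fun i j => M i j / max 1 (Real.sqrt (∑ i', M i' j ^ 2))

/-- The attention matrix `Softmax (Uᵀ A U / √r)`. -/
def attention {r n : ℕ} (A : Matrix (Fin r) (Fin r) ℝ) (U : Matrix (Fin r) (Fin n) ℝ) :
    Matrix (Fin n) (Fin n) ℝ :=
  colSoftmax ((Real.sqrt r)⁻¹ • (Uᵀ * A * U))

/-- One softmax-attention layer, `Clip (V U Attn(U))`. -/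
def layer {m r n : ℕ} (A : Matrix (Fin r) (Fin r) ℝ) (V : Matrix (Fin m) (Fin r) ℝ)
    (U : Matrix (Fin r) (Fin n) ℝ) : Matrix (Fin m) (Fin n) ℝ :=
  clip (V * U * attention A U)

/-- The entries of a real `m × n` matrix, with the product `σ`-algebra. -/
abbrev Entries (m n : ℕ) : Type := Fin m → Fin n → ℝ

/-- The weights of a transformer of depth `L ≥ 1`, vocabulary size `d` and attention dimension `r`:
a pair `(A, V)` of `r × r` matrices for each of the layers `1, …, L - 1`, and a pair `(A, V)` with
`A` of size `r × r` and `V` of size `d × r` for the last layer. -/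
abbrev Weights (d r L : ℕ) : Type :=
  (Fin (L - 1) → Entries r r × Entries r r) × (Entries r r × Entries d r)

/-- The output of the last layer of the transformer with weights `θ` on the input `U`. The layers
are applied in the order `1, 2, …, L`. -/
def output {d r L n : ℕ} (θ : Weights d r L) (U : Matrix (Fin r) (Fin n) ℝ) :
    Matrix (Fin d) (Fin n) ℝ :=
  layer (Matrix.of θ.2.1) (Matrix.of θ.2.2)
    (Fin.foldl (L - 1) (fun U' l => layer (Matrix.of (θ.1 l).1) (Matrix.of (θ.1 l).2) U') U)

/-- The embeddings of the tokens in the context window at time `t`, in chronological order. For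
`K ≥ 1` the window consists of the last `min K (t + 1) = min (K - 1) t + 1` tokens of
`x₀, …, x_t`: the last `K` tokens, or all of them as long as there are at most `K`. -/
def contextEmbedding {d r : ℕ} (K : ℕ) (Φ : Fin d → EuclideanSpace ℝ (Fin r)) (t : ℕ)
    (x : Fin (t + 1) → Fin d) : Matrix (Fin r) (Fin (min (K - 1) t + 1)) ℝ :=
  Matrix.of fun i j => Φ (x ⟨t - min (K - 1) t + j, by have := j.isLt; omega⟩) i

/-- The distribution of the token after `x₀, …, x_t`: the softmax of the right-most column of the
output of the transformer on the context window. -/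
def nextToken {d r L : ℕ} (K : ℕ) (Φ : Fin d → EuclideanSpace ℝ (Fin r)) (θ : Weights d r L)
    (t : ℕ) (x : Fin (t + 1) → Fin d) : Fin d → ℝ :=
  softmax fun i => output θ (contextEmbedding K Φ t x) i (Fin.last _)

/-! ### The prior -/

/-- The law of an `m × n` matrix with iid standard Gaussian entries. -/
def gaussianEntries (m n : ℕ) : Measure (Entries m n) :=
  Measure.pi fun _ => Measure.pi fun _ => gaussianReal 0 1

/-- The uniform distribution on the unit sphere of `ℝ^r` with the Euclidean norm: the normalized
surface measure. -/
def uniformSphere (r : ℕ) : Measure (Fin r → ℝ) :=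
  let S := (volume : Measure (EuclideanSpace ℝ (Fin r))).toSphere
  ((S Set.univ)⁻¹ • S).map
    fun x : Metric.sphere (0 : EuclideanSpace ℝ (Fin r)) 1 => WithLp.ofLp x.1

/-- The law of an `m × r` matrix whose rows are iid uniform on the unit sphere of `ℝ^r`. -/
def sphericalRows (m r : ℕ) : Measure (Entries m r) :=
  Measure.pi fun _ => uniformSphere r

/-- The prior: all the matrices are independent, the `A`'s have iid `N(0,1)` entries, the `V`'s
have iid rows that are uniform on the unit sphere. -/
def prior (d r L : ℕ) : Measure (Weights d r L) :=
  (Measure.pi fun _ => (gaussianEntries r r).prod (sphericalRows r r)).prod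
    ((gaussianEntries r r).prod (sphericalRows d r))

/-! ### The data generating process -/

variable {Ω : Type*} [MeasurableSpace Ω]

/-- The history `H_t = (X₀, …, X_t)`. -/
def history {d : ℕ} (X : ℕ → Ω → Fin d) (t : ℕ) (ω : Ω) : Fin (t + 1) → Fin d :=
  fun i => X i ω

/-- The conditional probability of the event `Y = y` given the random variable `Z`. -/
def condProb {α β : Type*} [MeasurableSpace β] (P : Measure Ω) (Y : Ω → α) (y : α)
    (Z : Ω → β) : Ω → ℝ :=
  P⟦Y ⁻¹' {y} | MeasurableSpace.comap Z inferInstance⟧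

/-- The tokens `X₀, X₁, …` are generated autoregressively by a random transformer with context
length `K`, embeddings `Φ` and weights `θ`: the weights follow the prior, `X₀` has an arbitrary law
and is independent of the weights, and given `θ` and `H_t` the next token `X_{t+1}` is drawn from
the softmax of the right-most column of the output of the transformer. -/
structure IsTransformerProcess {d r L : ℕ} (K : ℕ) (Φ : Fin d → EuclideanSpace ℝ (Fin r))
    (θ : Ω → Weights d r L) (X : ℕ → Ω → Fin d) (P : Measure Ω) : Prop where
  measurable_weights : Measurable θ
  measurable_token : ∀ t, Measurable (X t)
  map_weights : P.map θ = prior d r L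
  indep_first : IndepFun (X 0) θ P
  next_token : ∀ (t : ℕ) (j : Fin d),
    condProb P (X (t + 1)) j (fun ω => (θ ω, history X t ω))
      =ᵐ[P] fun ω => nextToken K Φ (θ ω) t (history X t ω) j

/-! ### The estimation error -/

/-- The conditional (Shannon) entropy `H(Y | Z)`, in nats, of a finitely valued `Y` given an
arbitrary random variable `Z`: the expected entropy of the conditional distribution. -/
def condEntropy {α β : Type*} [Fintype α] [MeasurableSpace β] (P : Measure Ω) (Y : Ω → α)
    (Z : Ω → β) : ℝ :=
  ∫ ω, ∑ y, Real.negMulLog (condProb P Y y Z ω) ∂P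

/-- The Bayesian posterior predictive probability `P(X_{t+1} = x | H_t = h)`. -/
def posterior {d : ℕ} (P : Measure Ω) (X : ℕ → Ω → Fin d) (t : ℕ) (h : Fin (t + 1) → Fin d)
    (x : Fin d) : ℝ :=
  (ProbabilityTheory.cond P (history X t ⁻¹' {h})).real (X (t + 1) ⁻¹' {x})

/-- The estimation error over horizon `T` of the optimal (Bayesian) predictor: its average expected
log-loss minus the average conditional entropy of the next token given the weights and the
history, which is the log-loss of the omniscient predictor. -/
def estimationError {d : ℕ} {Θ : Type*} [MeasurableSpace Θ] (P : Measure Ω) (θ : Ω → Θ)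
    (X : ℕ → Ω → Fin d) (T : ℕ) : ℝ :=
  (∑ t ∈ Finset.range T,
      ∫ ω, -Real.log (posterior P X t (history X t ω) (X (t + 1) ω)) ∂P) / T
    - (∑ t ∈ Finset.range T,
      condEntropy P (X (t + 1)) (fun ω => (θ ω, history X t ω))) / T

end TransformerProcess

end

/-! The entropies telescope. `T` times the estimation error is the mutual information between
weights and tokens, that is, the prior average of the relative entropy of the path law of `a` with
respect to the Bayesian mixture (`estimationError_eq`). A mixture predicts almost as well as any
component with enough similar components around it. Keeping only a set `N` of weights and applying
Jensen, that relative entropy is at most `-log π(N) + T δ`, where `δ` bounds the one-step relative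
entropy from `a` to the members of `N` (`IsPredictorFamily.sum_log_mixLik_le`). No covering is
needed: `estimationError_le` reduces everything to a trade-off between prior mass and closeness, and
`N` may depend on `a`.

Closeness: logits that differ by at most `ε ≤ 1` have relative entropy at most `ε²`
(`sum_softmax_mul_log_sub_le_sq`). Clipping is nonexpansive and softmax is 1-Lipschitz from the sup
norm to `ℓ¹`, so in the largest column distance a layer has Lipschitz constant `‖V‖ (1 + 2‖A‖/√r)`,
whatever the number of columns. `N` is a box around `a` whose tolerance in each hidden layer is
divided by bounds, read off from `a` itself, for the Lipschitz constants of the later layers. Each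
layer then contributes at most `ε / L` (`abs_output_sub_le_of_mem_weightBox`).

Mass: each parameter costs about `log (1 / tolerance)`, a sum of logarithms of operator norms over
the later layers. Under the prior these logarithms have dimension-free means, because the normalized
operator norms have bounded second moments (`integral_norm_act_sq_le`). A layer pays for all layers
after it, hence the `L²` (`hasMeanLE_boxCost`).

Balance: with `B = r max(r, d) L` the choice `ε² = B / T` makes `T ε² = B`. If `T < B`, the whole
parameter space serves as `N` with `δ = 4`. In the estimates `K` matters only through `1 ≤ K`. -/

noncomputable section

namespace TransformerProcess

/-! ### Path likelihoods of autoregressive predictors -/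

section Path

variable {d : ℕ}

/-- The likelihood of `x₁, …, x_T` given `x₀` under the autoregressive predictor `q`. -/
def pathLik (q : (t : ℕ) → (Fin (t + 1) → Fin d) → Fin d → ℝ) :
    (T : ℕ) → (Fin (T + 1) → Fin d) → ℝ
  | 0, _ => 1
  | T + 1, x => pathLik q T (Fin.init x) * q T (Fin.init x) (x (Fin.last (T + 1)))

/-- A path is its initial segment followed by its last token; every induction on the horizon sums
over the last token first. -/
theorem sum_path_succ {M : Type*} [AddCommMonoid M] {t : ℕ}
    (F : (Fin (t + 1) → Fin d) → Fin d → M) :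
    ∑ x : Fin (t + 1 + 1) → Fin d, F (Fin.init x) (x (Fin.last (t + 1)))
      = ∑ h : Fin (t + 1) → Fin d, ∑ j, F h j := by
  rw [← (Fin.snocEquiv (fun _ : Fin (t + 1 + 1) => Fin d)).sum_comp, Fintype.sum_prod_type,
    Finset.sum_comm]
  simp [Fin.snocEquiv]

theorem init_zero {t : ℕ} (x : Fin (t + 1 + 1) → Fin d) :
    (Fin.init x : Fin (t + 1) → Fin d) 0 = x 0 := rfl

theorem pathLik_pos {q : (t : ℕ) → (Fin (t + 1) → Fin d) → Fin d → ℝ}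
    (hq : ∀ t h j, 0 < q t h j) : ∀ (T : ℕ) (x : Fin (T + 1) → Fin d), 0 < pathLik q T x
  | 0, _ => one_pos
  | T + 1, _ => mul_pos (pathLik_pos hq T _) (hq _ _ _)

theorem pathLik_le_one {q : (t : ℕ) → (Fin (t + 1) → Fin d) → Fin d → ℝ}
    (hq : ∀ t h j, 0 < q t h j) (hs : ∀ t h, ∑ j, q t h j = 1) :
    ∀ (T : ℕ) (x : Fin (T + 1) → Fin d), pathLik q T x ≤ 1
  | 0, _ => le_rfl
  | T + 1, x => by
    refine mul_le_one₀ (pathLik_le_one hq hs T _) (hq _ _ _).le ?_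
    rw [← hs T (Fin.init x)]
    exact Finset.single_le_sum (fun j _ => (hq T _ j).le) (Finset.mem_univ _)

/-- This uniform lower bound keeps the log-likelihoods bounded, which gives their integrability
under every finite measure. -/
theorem pow_le_pathLik {q : (t : ℕ) → (Fin (t + 1) → Fin d) → Fin d → ℝ} {c : ℝ} (hc : 0 < c)
    (hq : ∀ t h j, c ≤ q t h j) : ∀ (T : ℕ) (x : Fin (T + 1) → Fin d), c ^ T ≤ pathLik q T x
  | 0, _ => by simp [pathLik]
  | T + 1, x => by
    rw [pow_succ]
    exact mul_le_mul (pow_le_pathLik hc hq T _) (hq _ _ _) hc.le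
      (pathLik_pos (fun t h j => hc.trans_le (hq t h j)) T _).le

theorem measurable_pathLik {Θ : Type*} [MeasurableSpace Θ]
    {q : Θ → (t : ℕ) → (Fin (t + 1) → Fin d) → Fin d → ℝ}
    (hq : ∀ t h j, Measurable fun a => q a t h j) :
    ∀ (T : ℕ) (x : Fin (T + 1) → Fin d), Measurable fun a => pathLik (q a) T x
  | 0, _ => measurable_const
  | T + 1, _ => (measurable_pathLik hq T _).mul (hq _ _ _)

/-- Chain rule for the relative entropy of two path laws, as an inequality. -/
theorem sum_pathLik_log_sub_le {q q' : (t : ℕ) → (Fin (t + 1) → Fin d) → Fin d → ℝ}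
    (hq : ∀ t h j, 0 < q t h j) (hs : ∀ t h, ∑ j, q t h j = 1) (hq' : ∀ t h j, 0 < q' t h j)
    {p : Fin d → ℝ} (hp : ∀ i, 0 ≤ p i) (hp1 : ∑ i, p i = 1) {δ : ℝ}
    (h : ∀ t h, ∑ j, q t h j * (Real.log (q t h j) - Real.log (q' t h j)) ≤ δ) (T : ℕ) :
    ∑ x : Fin (T + 1) → Fin d, p (x 0) * pathLik q T x = 1 ∧
    ∑ x : Fin (T + 1) → Fin d, p (x 0) * pathLik q T x *
      (Real.log (pathLik q T x) - Real.log (pathLik q' T x)) ≤ T * δ := by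
  induction T with
  | zero =>
    simp only [pathLik, mul_one, sub_self, mul_zero, Finset.sum_const_zero, Nat.cast_zero, zero_mul,
      le_refl, and_true]
    rw [← hp1, ← (Equiv.funUnique (Fin 1) (Fin d)).sum_comp]
    rfl
  | succ T ih =>
    obtain ⟨ih1, ih2⟩ := ih
    have e1 := sum_path_succ (t := T) (fun h j => p (h 0) * (pathLik q T h * q T h j))
    have e2 := sum_path_succ (t := T) (fun h j => p (h 0) * (pathLik q T h * q T h j) *
      (Real.log (pathLik q T h * q T h j) - Real.log (pathLik q' T h * q' T h j)))
    constructor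
    · refine Eq.trans e1 (Eq.trans (Finset.sum_congr rfl fun x _ => ?_) ih1)
      rw [← Finset.mul_sum, ← Finset.mul_sum, hs, mul_one]
    · refine (le_of_eq e2).trans ?_
      have : ∀ x : Fin (T + 1) → Fin d, ∑ j, p (x 0) * (pathLik q T x * q T x j) *
          (Real.log (pathLik q T x * q T x j) - Real.log (pathLik q' T x * q' T x j))
          ≤ p (x 0) * pathLik q T x * (Real.log (pathLik q T x) - Real.log (pathLik q' T x))
            + p (x 0) * pathLik q T x * δ := by
        intro x
        have hl : ∀ j, Real.log (pathLik q T x * q T x j) - Real.log (pathLik q' T x * q' T x j)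
            = (Real.log (pathLik q T x) - Real.log (pathLik q' T x))
              + (Real.log (q T x j) - Real.log (q' T x j)) := fun j => by
          rw [Real.log_mul (pathLik_pos hq T x).ne' (hq _ _ _).ne',
            Real.log_mul (pathLik_pos hq' T x).ne' (hq' _ _ _).ne']
          ring
        have : ∀ j, p (x 0) * (pathLik q T x * q T x j) *
          (Real.log (pathLik q T x * q T x j) - Real.log (pathLik q' T x * q' T x j)) =
          p (x 0) * pathLik q T x * (Real.log (pathLik q T x) - Real.log (pathLik q' T x)) * q T x j
          + p (x 0) * pathLik q T x *
            (q T x j * (Real.log (q T x j) - Real.log (q' T x j))) := fun j => by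
          rw [hl]; ring
        simp_rw [this]
        rw [Finset.sum_add_distrib, ← Finset.mul_sum, ← Finset.mul_sum, hs, mul_one]
        have := mul_nonneg (hp (x 0)) (pathLik_pos hq T x).le
        gcongr
        exact h _ _
      refine (Finset.sum_le_sum fun x _ => this x).trans ?_
      -- The normalization, carried along in the induction, gives the new error term `δ` total
      -- weight one.
      rw [Finset.sum_add_distrib, ← Finset.sum_mul, ih1]
      push_cast
      linarith

end Path

/-! ### Bayesian mixtures -/

section Mixture

variable {d : ℕ} {Θ : Type*} [MeasurableSpace Θ]

/-- The likelihood of a path under the mixture of the predictors `q a` with mixing law `π`. -/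
def mixLik (π : Measure Θ) (q : Θ → (t : ℕ) → (Fin (t + 1) → Fin d) → Fin d → ℝ) (T : ℕ)
    (x : Fin (T + 1) → Fin d) : ℝ :=
  ∫ a, pathLik (q a) T x ∂π

/-- Measurable families of predictors with values in `[c, 1]`. -/
structure IsPredictorFamily (q : Θ → (t : ℕ) → (Fin (t + 1) → Fin d) → Fin d → ℝ) (c : ℝ) :
    Prop where
  pos : 0 < c
  le : ∀ a t h j, c ≤ q a t h j
  sum : ∀ a t h, ∑ j, q a t h j = 1
  measurable : ∀ t h j, Measurable fun a => q a t h j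

variable {π : Measure Θ} {q : Θ → (t : ℕ) → (Fin (t + 1) → Fin d) → Fin d → ℝ} {c : ℝ}

namespace IsPredictorFamily

theorem q_pos (hq : IsPredictorFamily q c) (a t h j) : 0 < q a t h j :=
  hq.pos.trans_le (hq.le a t h j)

theorem q_le_one (hq : IsPredictorFamily q c) (a t h j) : q a t h j ≤ 1 := by
  rw [← hq.sum a t h]
  exact Finset.single_le_sum (fun j _ => (hq.q_pos a t h j).le) (Finset.mem_univ _)

theorem lik_pos (hq : IsPredictorFamily q c) (a T x) : 0 < pathLik (q a) T x :=
  pathLik_pos (hq.q_pos a) T x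

theorem lik_le_one (hq : IsPredictorFamily q c) (a T x) : pathLik (q a) T x ≤ 1 :=
  pathLik_le_one (hq.q_pos a) (hq.sum a) T x

theorem measurable_lik (hq : IsPredictorFamily q c) (T x) :
    Measurable fun a => pathLik (q a) T x :=
  measurable_pathLik hq.measurable T x

theorem abs_log_lik_le (hq : IsPredictorFamily q c) (a T x) :
    |Real.log (pathLik (q a) T x)| ≤ -Real.log (c ^ T) := by
  rw [abs_of_nonpos (Real.log_nonpos (hq.lik_pos a T x).le (hq.lik_le_one a T x))]
  exact neg_le_neg (Real.log_le_log (pow_pos hq.pos T) (pow_le_pathLik hq.pos (hq.le a) T x))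

theorem integrable_lik [IsFiniteMeasure π] (hq : IsPredictorFamily q c) (T x) :
    Integrable (fun a => pathLik (q a) T x) π :=
  Integrable.of_bound (hq.measurable_lik T x).aestronglyMeasurable 1
    (.of_forall fun a => by
      rw [Real.norm_eq_abs, abs_of_pos (hq.lik_pos a T x)]; exact hq.lik_le_one a T x)

theorem integrable_log_lik {ν : Measure Θ} [IsFiniteMeasure ν] (hq : IsPredictorFamily q c)
    (T x) : Integrable (fun a => Real.log (pathLik (q a) T x)) ν :=
  Integrable.of_bound (hq.measurable_lik T x).log.aestronglyMeasurable _
    (.of_forall fun a => by rw [Real.norm_eq_abs]; exact hq.abs_log_lik_le a T x)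

theorem mixLik_pos [IsProbabilityMeasure π] (hq : IsPredictorFamily q c) (T x) :
    0 < mixLik π q T x := by
  refine (pow_pos hq.pos T).trans_le ?_
  have := integral_mono (μ := π) (integrable_const (c ^ T)) (hq.integrable_lik T x)
    (fun a => pow_le_pathLik hq.pos (hq.le a) T x)
  simpa [mixLik] using this

/-- The logarithmic regret of a Bayesian mixture in terms of the prior mass of a set of parameters
that are close to the true one. -/
theorem sum_log_mixLik_le [IsProbabilityMeasure π] (hq : IsPredictorFamily q c) {p : Fin d → ℝ}
    (hp : ∀ i, 0 ≤ p i) (hp1 : ∑ i, p i = 1) (a : Θ) {N : Set Θ} (hN : MeasurableSet N)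
    (hN0 : 0 < π.real N) {δ : ℝ}
    (h : ∀ b ∈ N, ∀ t h, ∑ j, q a t h j * (Real.log (q a t h j) - Real.log (q b t h j)) ≤ δ)
    (T : ℕ) :
    ∑ x : Fin (T + 1) → Fin d, p (x 0) * pathLik (q a) T x *
      (Real.log (pathLik (q a) T x) - Real.log (mixLik π q T x))
      ≤ -Real.log (π.real N) + T * δ := by
  have hN' : π N ≠ 0 := fun h0 => by simp [Measure.real, h0] at hN0
  set ν := ProbabilityTheory.cond π N with hν
  have : IsProbabilityMeasure ν := cond_isProbabilityMeasure hN'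
  -- The mixture restricted to `N` is `π(N)` times an average under the conditioned prior `ν`;
  -- Jensen for `exp` moves the logarithm inside that average.
  have key : ∀ x, Real.log (π.real N) + ∫ b, Real.log (pathLik (q b) T x) ∂ν
      ≤ Real.log (mixLik π q T x) := by
    intro x
    rw [Real.le_log_iff_exp_le (hq.mixLik_pos T x), Real.exp_add, Real.exp_log hN0]
    have j := convexOn_exp.map_integral_le (μ := ν) Real.continuous_exp.continuousOn isClosed_univ
      (.of_forall fun _ => Set.mem_univ _) (hq.integrable_log_lik T x)
      (by
        simp only [Function.comp_def, Real.exp_log (hq.lik_pos _ T x)]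
        exact hq.integrable_lik T x)
    simp only [Real.exp_log (hq.lik_pos _ T x)] at j
    refine (mul_le_mul_of_nonneg_left j hN0.le).trans ?_
    have : ∫ b, pathLik (q b) T x ∂ν = (π.real N)⁻¹ * ∫ b in N, pathLik (q b) T x ∂π := by
      rw [hν, ProbabilityTheory.cond, integral_smul_measure, ENNReal.toReal_inv, smul_eq_mul]
      rfl
    rw [this, mul_inv_cancel_left₀ hN0.ne']
    exact setIntegral_le_integral (hq.integrable_lik T x)
      (.of_forall fun b => (hq.lik_pos b T x).le)
  have hw : ∀ x : Fin (T + 1) → Fin d, 0 ≤ p (x 0) * pathLik (q a) T x := fun x =>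
    mul_nonneg (hp _) (hq.lik_pos a T x).le
  -- Only the normalization is wanted here, so the predictor is compared with itself.
  have hsum1 := (sum_pathLik_log_sub_le (hq.q_pos a) (hq.sum a) (hq.q_pos a) hp hp1
    (δ := 0) (by simp) T).1
  calc _ ≤ ∑ x : Fin (T + 1) → Fin d, p (x 0) * pathLik (q a) T x *
      (-Real.log (π.real N) +
        ∫ b, (Real.log (pathLik (q a) T x) - Real.log (pathLik (q b) T x)) ∂ν) := by
        refine Finset.sum_le_sum fun x _ => mul_le_mul_of_nonneg_left ?_ (hw x)
        rw [integral_sub (integrable_const _) (hq.integrable_log_lik T x)]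
        simp only [integral_const, probReal_univ, one_smul]
        linarith [key x]
    _ = -Real.log (π.real N) + ∫ b, (∑ x : Fin (T + 1) → Fin d, p (x 0) * pathLik (q a) T x *
        (Real.log (pathLik (q a) T x) - Real.log (pathLik (q b) T x))) ∂ν := by
        simp_rw [mul_add]
        rw [Finset.sum_add_distrib, ← Finset.sum_mul, hsum1, one_mul, integral_finsetSum]
        · simp_rw [integral_const_mul]
        · intro x _
          exact ((integrable_const _).sub (hq.integrable_log_lik T x)).const_mul _
    _ ≤ _ := by
        gcongr
        have hae : ∀ᵐ b ∂ν, b ∈ N := by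
          rw [hν]; exact ae_cond_mem hN
        calc _ ≤ ∫ _, (T * δ) ∂ν := by
              refine integral_mono_ae (integrable_finsetSum _ fun x _ =>
                ((integrable_const _).sub (hq.integrable_log_lik T x)).const_mul _)
                (integrable_const _) ?_
              filter_upwards [hae] with b hb
              exact (sum_pathLik_log_sub_le (hq.q_pos a) (hq.sum a) (hq.q_pos b) hp hp1
                (h b hb) T).2
          _ = _ := by simp

end IsPredictorFamily

end Mixture

/-! ### The estimation error as an average relative entropy -/

section Generation

variable {d : ℕ}

theorem history_succ_eq_iff {Ω : Type*} {X : ℕ → Ω → Fin d} {t : ℕ} {ω : Ω} {x : Fin (t + 1 + 1) → Fin d} :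
    history X (t + 1) ω = x ↔ history X t ω = Fin.init x ∧ X (t + 1) ω = x (Fin.last (t + 1)) := by
  constructor
  · rintro rfl
    exact ⟨rfl, rfl⟩
  · rintro ⟨h1, h2⟩
    rw [← Fin.snoc_init_self x, ← h1, ← h2]
    ext i
    refine Fin.lastCases ?_ (fun i => ?_) i
    · simp [history]
    · simp [history]

variable {Θ : Type*} [MeasurableSpace Θ] {Ω : Type*} [MeasurableSpace Ω]

theorem measurable_history {X : ℕ → Ω → Fin d} (hX : ∀ t, Measurable (X t)) (t : ℕ) :
    Measurable (history X t) :=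
  measurable_pi_lambda _ fun i => hX i

theorem integral_comp_eq_sum {β : Type*} [Fintype β] [MeasurableSpace β]
    [MeasurableSingletonClass β] {P : Measure Ω} [IsFiniteMeasure P] {Y : Ω → β}
    (hY : Measurable Y) (F : β → ℝ) :
    ∫ ω, F (Y ω) ∂P = ∑ y, P.real (Y ⁻¹' {y}) * F y := by
  rw [← integral_map (φ := Y) (f := F) hY.aemeasurable (measurable_of_finite F).aestronglyMeasurable,
    integral_fintype Integrable.of_finite]
  refine Finset.sum_congr rfl fun y _ => ?_
  rw [map_measureReal_apply hY (measurableSet_singleton y), smul_eq_mul]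

theorem integral_eq_sum_setIntegral {β : Type*} [Fintype β] [MeasurableSpace β]
    [MeasurableSingletonClass β] {P : Measure Ω} {Y : Ω → β}
    (hY : Measurable Y) {F : Ω → ℝ} (hF : Integrable F P) :
    ∫ ω, F ω ∂P = ∑ y, ∫ ω in Y ⁻¹' {y}, F ω ∂P := by
  rw [← integral_iUnion_fintype (fun y => hY (measurableSet_singleton y)) _
    (fun y => hF.integrableOn)]
  · rw [← Set.preimage_iUnion, Set.iUnion_of_singleton, Set.preimage_univ, setIntegral_univ]
  · intro a b hab
    exact Disjoint.preimage _ (by simpa using hab)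

variable {P : Measure Ω} [IsProbabilityMeasure P] {θ : Ω → Θ} {X : ℕ → Ω → Fin d}
  {q : Θ → (t : ℕ) → (Fin (t + 1) → Fin d) → Fin d → ℝ} {c : ℝ} {π : Measure Θ}

/-- Given `θ` and the history, the next token is sampled from `q`. -/
theorem setIntegral_history_succ (hθ : Measurable θ) (hX : ∀ t, Measurable (X t))
    (hnext : ∀ t j, condProb P (X (t + 1)) j (fun ω => (θ ω, history X t ω))
      =ᵐ[P] fun ω => q (θ ω) t (history X t ω) j)
    {f : Θ → ℝ} (hf : Measurable f) {C : ℝ} (hC : ∀ a, |f a| ≤ C)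
    (t : ℕ) (x : Fin (t + 1 + 1) → Fin d) :
    ∫ ω in history X (t + 1) ⁻¹' {x}, f (θ ω) ∂P
      = ∫ ω in history X t ⁻¹' {Fin.init x},
          f (θ ω) * q (θ ω) t (Fin.init x) (x (Fin.last (t + 1))) ∂P := by
  set h := (Fin.init x : Fin (t + 1) → Fin d) with hh
  set j := x (Fin.last (t + 1)) with hj
  set Z : Ω → Θ × (Fin (t + 1) → Fin d) := fun ω => (θ ω, history X t ω) with hZ
  have hZm : Measurable Z := hθ.prodMk (measurable_history hX t)
  have hm0 := hZm.comap_le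
  set A := history X t ⁻¹' {h}
  have hA : MeasurableSet A := measurable_history hX t (measurableSet_singleton h)
  have hAm : MeasurableSet[MeasurableSpace.comap Z inferInstance] A :=
    ⟨Prod.snd ⁻¹' {h}, measurable_snd (measurableSet_singleton h), rfl⟩
  set B := X (t + 1) ⁻¹' {j}
  have hB : MeasurableSet B := hX _ (measurableSet_singleton j)
  have hsplit : history X (t + 1) ⁻¹' {x} = A ∩ B := by
    ext ω
    exact history_succ_eq_iff
  have hfm : StronglyMeasurable[MeasurableSpace.comap Z inferInstance] (fun ω => f (θ ω)) :=
    ((hf.comp measurable_fst).comp (comap_measurable Z)).stronglyMeasurable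
  have hbound : Integrable (fun ω => f (θ ω)) P :=
    Integrable.of_bound (hf.comp hθ).aestronglyMeasurable C (.of_forall fun ω => hC _)
  have hBint : Integrable (B.indicator (fun _ => (1 : ℝ))) P :=
    (integrable_const _).indicator hB
  have hprod : Integrable ((fun ω => f (θ ω)) * B.indicator (fun _ => (1 : ℝ))) P := by
    have : (fun ω => f (θ ω)) * B.indicator (fun _ => (1 : ℝ)) = B.indicator fun ω => f (θ ω) := by
      ext ω
      by_cases hω : ω ∈ B <;> simp [hω]
    rw [this]
    exact hbound.indicator hB
  -- `f (θ ω)` is measurable for the conditioning σ-algebra, so it can be pulled out, and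
  -- conditioning turns the indicator of the next token into `q`.
  have pull := condExp_mul_of_stronglyMeasurable_left hfm hprod hBint
  calc ∫ ω in history X (t + 1) ⁻¹' {x}, f (θ ω) ∂P
      = ∫ ω in A, ((fun ω => f (θ ω)) * B.indicator (fun _ => (1 : ℝ))) ω ∂P := by
        rw [hsplit, ← setIntegral_indicator hB]
        refine integral_congr_ae (.of_forall fun ω => ?_)
        by_cases hω : ω ∈ B <;> simp [hω]
    _ = ∫ ω in A, (P[(fun ω => f (θ ω)) * B.indicator (fun _ => (1 : ℝ)) | MeasurableSpace.comap Z inferInstance]) ω ∂P :=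
        (setIntegral_condExp hm0 hprod hAm).symm
    _ = ∫ ω in A, f (θ ω) * q (θ ω) t h j ∂P := by
        refine setIntegral_congr_ae hA ?_
        filter_upwards [pull, hnext t j] with ω h1 h2 h3
        rw [h1, Pi.mul_apply]
        have h4 : history X t ω = h := h3
        rw [← h4]
        congr 1

/-- The joint law of the parameter and the history. -/
theorem setIntegral_history (hθ : Measurable θ) (hX : ∀ t, Measurable (X t))
    (hmap : P.map θ = π) (hind : IndepFun (X 0) θ P)
    (hnext : ∀ t j, condProb P (X (t + 1)) j (fun ω => (θ ω, history X t ω))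
      =ᵐ[P] fun ω => q (θ ω) t (history X t ω) j) (hq : IsPredictorFamily q c) (t : ℕ) :
    ∀ (x : Fin (t + 1) → Fin d) {f : Θ → ℝ} (_ : Measurable f) {C : ℝ} (_ : ∀ a, |f a| ≤ C),
      ∫ ω in history X t ⁻¹' {x}, f (θ ω) ∂P
        = P.real (X 0 ⁻¹' {x 0}) * ∫ a, f a * pathLik (q a) t x ∂π := by
  induction t with
  | zero =>
    intro x f hf C hC
    have hA : MeasurableSet (X 0 ⁻¹' {x 0}) := hX 0 (measurableSet_singleton _)
    have e : history X 0 ⁻¹' {x} = X 0 ⁻¹' {x 0} := by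
      ext ω
      simp only [Set.mem_preimage, Set.mem_singleton_iff]
      constructor
      · rintro rfl; rfl
      · intro h
        ext i
        obtain rfl : i = 0 := Fin.fin_one_eq_zero i
        rw [← h]
        rfl
    have h1 : ∫ ω, (Set.indicator {x 0} (fun _ => (1 : ℝ)) (X 0 ω)) * f (θ ω) ∂P
        = (∫ ω, Set.indicator {x 0} (fun _ => (1 : ℝ)) (X 0 ω) ∂P) * ∫ ω, f (θ ω) ∂P :=
      (hind.comp (φ := Set.indicator {x 0} (fun _ => (1 : ℝ))) (ψ := f)
        (measurable_of_finite _) hf).integral_fun_mul_eq_mul_integral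
        ((measurable_of_finite _).comp (hX 0)).aestronglyMeasurable
        (hf.comp hθ).aestronglyMeasurable
    have h2 : ∀ ω, Set.indicator {x 0} (fun _ => (1 : ℝ)) (X 0 ω)
        = (X 0 ⁻¹' {x 0}).indicator (fun _ => (1 : ℝ)) ω := fun ω => rfl
    simp only [pathLik, mul_one]
    rw [e, ← hmap, integral_map hθ.aemeasurable hf.aestronglyMeasurable, ← integral_indicator hA]
    simp only [h2] at h1
    rw [integral_indicator_const _ hA, smul_eq_mul, mul_one] at h1
    rw [← h1]
    refine integral_congr_ae (.of_forall fun ω => ?_)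
    by_cases hω : ω ∈ X 0 ⁻¹' {x 0} <;> simp [hω]
  | succ t ih =>
    intro x f hf C hC
    -- The probability of the last token is absorbed into the test function, which is why the
    -- induction runs over all bounded measurable `f`.
    rw [setIntegral_history_succ hθ hX hnext hf hC t x,
      ih (Fin.init x) (f := fun a => f a * q a t (Fin.init x) (x (Fin.last (t + 1))))
      (hf.mul (hq.measurable _ _ _)) (C := C) ?_]
    · simp only [pathLik, init_zero]
      congr 2
      ext a
      ring
    · intro a
      rw [abs_mul, abs_of_pos (hq.q_pos a _ _ _)]
      calc _ ≤ C * 1 := mul_le_mul (hC a) (hq.q_le_one _ _ _ _) (hq.q_pos a _ _ _).le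
            ((abs_nonneg _).trans (hC a))
        _ = C := mul_one C

theorem measureReal_history (hθ : Measurable θ) (hX : ∀ t, Measurable (X t))
    (hmap : P.map θ = π) (hind : IndepFun (X 0) θ P)
    (hnext : ∀ t j, condProb P (X (t + 1)) j (fun ω => (θ ω, history X t ω))
      =ᵐ[P] fun ω => q (θ ω) t (history X t ω) j) (hq : IsPredictorFamily q c) (t : ℕ)
    (x : Fin (t + 1) → Fin d) :
    P.real (history X t ⁻¹' {x}) = P.real (X 0 ⁻¹' {x 0}) * mixLik π q t x := by
  have := setIntegral_history hθ hX hmap hind hnext hq t x (f := fun _ => 1)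
    measurable_const (C := 1) (by simp)
  simpa [mixLik] using this

/-- From one horizon to the next, the average relative entropy grows by the Bayesian log-loss minus
the conditional entropy of the new token, and it vanishes at horizon zero; the sums telescope. -/
theorem estimationError_eq [IsProbabilityMeasure π] (hθ : Measurable θ)
    (hX : ∀ t, Measurable (X t))
    (hmap : P.map θ = π) (hind : IndepFun (X 0) θ P)
    (hnext : ∀ t j, condProb P (X (t + 1)) j (fun ω => (θ ω, history X t ω))
      =ᵐ[P] fun ω => q (θ ω) t (history X t ω) j) (hq : IsPredictorFamily q c) (T : ℕ) :
    estimationError P θ X T = (∫ a, ∑ x : Fin (T + 1) → Fin d,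
      P.real (X 0 ⁻¹' {x 0}) * pathLik (q a) T x *
        (Real.log (pathLik (q a) T x) - Real.log (mixLik π q T x)) ∂π) / T := by
  set p : Fin d → ℝ := fun i => P.real (X 0 ⁻¹' {i}) with hp
  have hlaw := setIntegral_history hθ hX hmap hind hnext hq
  have hhist := measureReal_history hθ hX hmap hind hnext hq
  -- the log-loss of the Bayesian predictor at time `t`
  have hloss : ∀ t, ∫ ω, -Real.log (posterior P X t (history X t ω) (X (t + 1) ω)) ∂P
      = ∑ x : Fin (t + 1 + 1) → Fin d, p (x 0) * mixLik π q (t + 1) x *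
        (Real.log (mixLik π q t (Fin.init x)) - Real.log (mixLik π q (t + 1) x)) := by
    intro t
    have := integral_comp_eq_sum (P := P) (measurable_history hX (t + 1))
      (fun x => -Real.log (posterior P X t (Fin.init x) (x (Fin.last (t + 1)))))
    refine Eq.trans this (Finset.sum_congr rfl fun x _ => ?_)
    rw [hhist (t + 1) x]
    -- If the first token has probability zero, the posterior is a default value, but its weight
    -- vanishes.
    rcases eq_or_ne (p (x 0)) 0 with h0 | h0
    · simp only [hp] at h0
      simp [hp, h0]
    congr 1
    have hpost : posterior P X t (Fin.init x) (x (Fin.last (t + 1)))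
        = mixLik π q (t + 1) x / mixLik π q t (Fin.init x) := by
      have hc : ∀ A B : Set Ω, MeasurableSet A →
          (ProbabilityTheory.cond P A).real B = P.real (A ∩ B) / P.real A := fun A B hA => by
        rw [Measure.real, cond_apply hA, ENNReal.toReal_mul, ENNReal.toReal_inv, div_eq_inv_mul]
        rfl
      rw [posterior, hc _ _ (measurable_history hX t (measurableSet_singleton _))]
      have e : history X t ⁻¹' {(Fin.init x : Fin (t + 1) → Fin d)}
          ∩ X (t + 1) ⁻¹' {x (Fin.last (t + 1))} = history X (t + 1) ⁻¹' {x} := by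
        ext ω
        exact history_succ_eq_iff.symm
      rw [e, hhist, hhist, init_zero]
      have := (hq.mixLik_pos (π := π) t (Fin.init x)).ne'
      simp only [hp] at h0
      field_simp
    rw [hpost, Real.log_div (hq.mixLik_pos _ _).ne' (hq.mixLik_pos _ _).ne']
    ring
  -- the conditional entropy at time `t`
  have hent : ∀ t, condEntropy P (X (t + 1)) (fun ω => (θ ω, history X t ω))
      = ∑ h : Fin (t + 1) → Fin d, p (h 0) *
        ∫ a, (∑ j, Real.negMulLog (q a t h j)) * pathLik (q a) t h ∂π := by
    intro t
    have hmeas : ∀ h : Fin (t + 1) → Fin d,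
        Measurable fun a => ∑ j, Real.negMulLog (q a t h j) := fun h =>
      Finset.measurable_sum _ fun j _ => Real.continuous_negMulLog.measurable.comp
        (hq.measurable t h j)
    have hbd : ∀ (h : Fin (t + 1) → Fin d) a,
        |∑ j, Real.negMulLog (q a t h j)| ≤ ∑ _j : Fin d, (-Real.log c) := fun h a => by
      refine (Finset.abs_sum_le_sum_abs _ _).trans (Finset.sum_le_sum fun j _ => ?_)
      have h1 := Real.log_le_log hq.pos (hq.le a t h j)
      have h2 := Real.log_nonpos (hq.q_pos a t h j).le (hq.q_le_one a t h j)
      have h3 := hq.q_pos a t h j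
      have h4 := hq.q_le_one a t h j
      rw [abs_of_nonneg (Real.negMulLog_nonneg h3.le h4), Real.negMulLog]
      nlinarith
    have h1 : condEntropy P (X (t + 1)) (fun ω => (θ ω, history X t ω))
        = ∫ ω, ∑ j, Real.negMulLog (q (θ ω) t (history X t ω) j) ∂P := by
      refine integral_congr_ae ?_
      filter_upwards [ae_all_iff.2 (hnext t)] with ω hω
      simp only [hω]
    have hint : Integrable (fun ω => ∑ j, Real.negMulLog (q (θ ω) t (history X t ω) j)) P := by
      refine Integrable.of_bound (Measurable.aestronglyMeasurable ?_) _
        (.of_forall fun ω => hbd (history X t ω) (θ ω))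
      exact (measurable_from_prod_countable_left (f := fun z : Θ × (Fin (t + 1) → Fin d) =>
        ∑ j, Real.negMulLog (q z.1 t z.2 j)) hmeas).comp (hθ.prodMk (measurable_history hX t))
    rw [h1, integral_eq_sum_setIntegral (measurable_history hX t) hint]
    refine Finset.sum_congr rfl fun h _ => ?_
    rw [← hlaw t h (hmeas h) (hbd h)]
    refine setIntegral_congr_fun (measurable_history hX t (measurableSet_singleton h)) ?_
    intro ω hω
    have hω : history X t ω = h := hω
    simp only [hω]
  have hiI : ∀ t (x : Fin (t + 1) → Fin d) (r : ℝ), Integrable (fun a => p (x 0) *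
      pathLik (q a) t x * (Real.log (pathLik (q a) t x) - r)) π := fun t x r => by
    have := ((hq.integrable_log_lik (ν := π) t x).sub (integrable_const r)).bdd_mul
      (hq.measurable_lik t x).aestronglyMeasurable (c := 1)
      (.of_forall fun a => by
        rw [Real.norm_eq_abs, abs_of_pos (hq.lik_pos a t x)]; exact hq.lik_le_one a t x)
    simpa only [mul_assoc, Pi.sub_apply] using this.const_mul (p (x 0))
  have hlI : ∀ t (x : Fin (t + 1) → Fin d), Integrable (fun a =>
      pathLik (q a) t x * Real.log (pathLik (q a) t x)) π := fun t x => by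
    exact (hq.integrable_log_lik (ν := π) t x).bdd_mul
      (hq.measurable_lik t x).aestronglyMeasurable (c := 1)
      (.of_forall fun a => by
        rw [Real.norm_eq_abs, abs_of_pos (hq.lik_pos a t x)]; exact hq.lik_le_one a t x)
  have hD : ∀ t, ∫ a, ∑ x : Fin (t + 1) → Fin d, p (x 0) * pathLik (q a) t x *
        (Real.log (pathLik (q a) t x) - Real.log (mixLik π q t x)) ∂π
      = ∑ x : Fin (t + 1) → Fin d, p (x 0) * (∫ a, pathLik (q a) t x *
        Real.log (pathLik (q a) t x) ∂π - mixLik π q t x * Real.log (mixLik π q t x)) := by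
    intro t
    rw [integral_finsetSum _ fun x _ => hiI t x _]
    refine Finset.sum_congr rfl fun x _ => ?_
    simp_rw [mul_assoc, mul_sub]
    rw [integral_sub ((hlI t x).const_mul _) (((hq.integrable_lik t x).mul_const _).const_mul _),
      integral_const_mul, integral_const_mul, integral_mul_const]
    rfl
  -- Consistency of the mixtures under forgetting the last token.
  have hmixsum : ∀ t (h : Fin (t + 1) → Fin d), ∑ j, ∫ a, pathLik (q a) t h * q a t h j ∂π
      = mixLik π q t h := by
    intro t h
    rw [← integral_finsetSum]
    · simp_rw [← Finset.mul_sum, hq.sum, mul_one]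
      rfl
    · intro j _
      exact (hq.integrable_lik t h).mul_bdd (c := 1) (hq.measurable t h j).aestronglyMeasurable
        (.of_forall fun a => by
          rw [Real.norm_eq_abs, abs_of_pos (hq.q_pos a _ _ _)]; exact hq.q_le_one a _ _ _)
  -- One step of the telescoping: `log (lik * q)` splits into the old log-likelihood and minus the
  -- entropy of `q`, while the mixture terms match the log-loss.
  have hstep : ∀ t, ∑ x : Fin (t + 1 + 1) → Fin d, p (x 0) * (∫ a, pathLik (q a) (t + 1) x *
        Real.log (pathLik (q a) (t + 1) x) ∂π
          - mixLik π q (t + 1) x * Real.log (mixLik π q (t + 1) x))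
      = ∑ x : Fin (t + 1) → Fin d, p (x 0) * (∫ a, pathLik (q a) t x *
        Real.log (pathLik (q a) t x) ∂π - mixLik π q t x * Real.log (mixLik π q t x))
        + ∫ ω, -Real.log (posterior P X t (history X t ω) (X (t + 1) ω)) ∂P
        - condEntropy P (X (t + 1)) (fun ω => (θ ω, history X t ω)) := by
    intro t
    rw [hloss, hent]
    have e1 := sum_path_succ (t := t) (fun h j => p (h 0) *
      ∫ a, pathLik (q a) t h * q a t h j * Real.log (pathLik (q a) t h * q a t h j) ∂π)
    have e2 := sum_path_succ (t := t) (fun h j => p (h 0) *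
      (∫ a, pathLik (q a) t h * q a t h j ∂π) * Real.log (mixLik π q t h))
    have e1' : ∑ x : Fin (t + 1 + 1) → Fin d, p (x 0) * ∫ a, pathLik (q a) (t + 1) x *
        Real.log (pathLik (q a) (t + 1) x) ∂π
        = ∑ h : Fin (t + 1) → Fin d, p (h 0) * (∫ a, pathLik (q a) t h *
        Real.log (pathLik (q a) t h) ∂π
          - ∫ a, (∑ j, Real.negMulLog (q a t h j)) * pathLik (q a) t h ∂π) := by
      refine Eq.trans e1 (Finset.sum_congr rfl fun h _ => ?_)
      have hi2 : Integrable (fun a => (∑ j, Real.negMulLog (q a t h j)) * pathLik (q a) t h) π := by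
        refine (hq.integrable_lik t h).bdd_mul (c := ∑ _j : Fin d, (-Real.log c))
          (Finset.measurable_sum _ fun j _ => Real.continuous_negMulLog.measurable.comp
          (hq.measurable t h j)).aestronglyMeasurable (.of_forall fun a => ?_)
        refine (Finset.abs_sum_le_sum_abs _ _).trans (Finset.sum_le_sum fun j _ => ?_)
        have h1 := Real.log_le_log hq.pos (hq.le a t h j)
        have h2 := Real.log_nonpos (hq.q_pos a t h j).le (hq.q_le_one a t h j)
        have h3 := hq.q_pos a t h j
        have h4 := hq.q_le_one a t h j
        rw [abs_of_nonneg (Real.negMulLog_nonneg h3.le h4), Real.negMulLog]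
        nlinarith
      rw [← Finset.mul_sum, ← integral_sub (hlI t h) hi2, ← integral_finsetSum]
      · congr 2
        ext a
        have : ∀ j, pathLik (q a) t h * q a t h j * Real.log (pathLik (q a) t h * q a t h j)
            = pathLik (q a) t h * Real.log (pathLik (q a) t h) * q a t h j
              - Real.negMulLog (q a t h j) * pathLik (q a) t h := fun j => by
          rw [Real.log_mul (hq.lik_pos a t h).ne' (hq.q_pos a t h j).ne', Real.negMulLog]
          ring
        simp_rw [this]
        rw [Finset.sum_sub_distrib, ← Finset.mul_sum, hq.sum, mul_one, ← Finset.sum_mul]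
      · intro j _
        have := hlI (t + 1) (Fin.snoc h j)
        simpa only [pathLik, Fin.init_snoc, Fin.snoc_last] using this
    have e2' : ∑ x : Fin (t + 1 + 1) → Fin d, p (x 0) * mixLik π q (t + 1) x *
        Real.log (mixLik π q t (Fin.init x))
        = ∑ h : Fin (t + 1) → Fin d, p (h 0) * (mixLik π q t h * Real.log (mixLik π q t h)) := by
      refine Eq.trans e2 (Finset.sum_congr rfl fun h _ => ?_)
      rw [← Finset.sum_mul, ← Finset.mul_sum, hmixsum, mul_assoc]
    simp only [mul_sub, Finset.sum_sub_distrib] at e1' e2' ⊢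
    rw [e1', e2']
    simp only [mul_assoc]
    ring
  have hzero : ∑ x : Fin (0 + 1) → Fin d, p (x 0) * (∫ a, pathLik (q a) 0 x *
        Real.log (pathLik (q a) 0 x) ∂π - mixLik π q 0 x * Real.log (mixLik π q 0 x)) = 0 := by
    refine Finset.sum_eq_zero fun x _ => ?_
    simp [mixLik, pathLik]
  rw [hD, estimationError, ← sub_div]
  congr 1
  clear hD
  induction T with
  | zero => rw [hzero]; simp
  | succ T ih =>
    rw [Finset.sum_range_succ, Finset.sum_range_succ, hstep, ← ih]
    ring

/-- Bound on the estimation error by the prior mass of neighbourhoods of the parameters. -/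
theorem estimationError_le [IsProbabilityMeasure π] (hθ : Measurable θ)
    (hX : ∀ t, Measurable (X t)) (hmap : P.map θ = π) (hind : IndepFun (X 0) θ P)
    (hnext : ∀ t j, condProb P (X (t + 1)) j (fun ω => (θ ω, history X t ω))
      =ᵐ[P] fun ω => q (θ ω) t (history X t ω) j) (hq : IsPredictorFamily q c) (T : ℕ) {δ : ℝ}
    {N : Θ → Set Θ} {g : Θ → ℝ} (hN : ∀ a, MeasurableSet (N a)) (hN0 : ∀ᵐ a ∂π, 0 < π.real (N a))
    (hNg : ∀ᵐ a ∂π, -Real.log (π.real (N a)) ≤ g a) (hg : Integrable g π)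
    (h : ∀ᵐ a ∂π, ∀ b ∈ N a, ∀ t h,
      ∑ j, q a t h j * (Real.log (q a t h j) - Real.log (q b t h j)) ≤ δ) :
    estimationError P θ X T ≤ (∫ a, g a ∂π + T * δ) / T := by
  rw [estimationError_eq hθ hX hmap hind hnext hq]
  refine div_le_div_of_nonneg_right ?_ T.cast_nonneg
  have hp1 : ∑ i, P.real (X 0 ⁻¹' {i}) = 1 := by
    have := integral_comp_eq_sum (P := P) (hX 0) (fun _ => 1)
    simpa using this.symm
  have : ∫ a, g a ∂π + T * δ = ∫ a, (g a + T * δ) ∂π := by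
    rw [integral_add hg (integrable_const _)]
    simp
  rw [this]
  refine integral_mono_ae ?_ (hg.add (integrable_const _)) ?_
  · refine integrable_finsetSum _ fun x _ => ?_
    have := ((hq.integrable_log_lik (ν := π) T x).sub
      (integrable_const (Real.log (mixLik π q T x)))).bdd_mul
      (hq.measurable_lik T x).aestronglyMeasurable (c := 1)
      (.of_forall fun a => by
        rw [Real.norm_eq_abs, abs_of_pos (hq.lik_pos a T x)]; exact hq.lik_le_one a T x)
    simpa only [mul_assoc, Pi.sub_apply] using this.const_mul (P.real (X 0 ⁻¹' {x 0}))
  · filter_upwards [hN0, hNg, h] with a h0 h1 h2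
    refine (hq.sum_log_mixLik_le (p := fun i => P.real (X 0 ⁻¹' {i})) (fun _ => measureReal_nonneg)
      hp1 a (hN a) h0 h2 T).trans ?_
    linarith

end Generation

/-! ### Softmax -/

section Softmax

variable {ι : Type*} [Fintype ι]

theorem softmax_nonneg (z : ι → ℝ) (i : ι) : 0 ≤ softmax z i :=
  div_nonneg (Real.exp_pos _).le (Finset.sum_nonneg fun _ _ => (Real.exp_pos _).le)

theorem sum_exp_pos [Nonempty ι] (z : ι → ℝ) : 0 < ∑ i, Real.exp (z i) :=
  Finset.sum_pos (fun _ _ => Real.exp_pos _) Finset.univ_nonempty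

theorem sum_softmax [Nonempty ι] (z : ι → ℝ) : ∑ i, softmax z i = 1 := by
  simp only [softmax]
  rw [← Finset.sum_div, div_self (sum_exp_pos z).ne']

theorem log_softmax [Nonempty ι] (z : ι → ℝ) (i : ι) :
    Real.log (softmax z i) = z i - Real.log (∑ j, Real.exp (z j)) := by
  rw [softmax, Real.log_div (Real.exp_pos _).ne' (sum_exp_pos z).ne', Real.log_exp]

/-- The numerator is at least `e^(-b)` and each term of the denominator at most `e^b`. Clipped
logits allow `b = 1`, which yields the constant of the predictor family. -/
theorem softmax_ge [Nonempty ι] {z : ι → ℝ} {b : ℝ} (hz : ∀ i, |z i| ≤ b) (i : ι) :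
    Real.exp (-(2 * b)) / Fintype.card ι ≤ softmax z i := by
  have h1 : ∑ j, Real.exp (z j) ≤ Fintype.card ι * Real.exp b := by
    calc _ ≤ ∑ _j : ι, Real.exp b :=
          Finset.sum_le_sum fun j _ => Real.exp_le_exp.2 (abs_le.1 (hz j)).2
      _ = _ := by simp
  have h2 : Real.exp (-b) ≤ Real.exp (z i) := Real.exp_le_exp.2 (abs_le.1 (hz i)).1
  have h3 : (0 : ℝ) < Fintype.card ι := Nat.cast_pos.2 Fintype.card_pos
  rw [softmax]
  calc Real.exp (-(2 * b)) / Fintype.card ι = Real.exp (-b) / (Fintype.card ι * Real.exp b) := by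
        rw [show -(2 * b) = -b - b by ring, Real.exp_sub, div_div, mul_comm (Real.exp b)]
    _ ≤ _ := div_le_div₀ (Real.exp_pos _).le h2 (sum_exp_pos z) h1

/-- The softmax is `1`-Lipschitz from the supremum norm to the `ℓ¹` norm. -/
theorem abs_sum_softmax_sub_mul_le [Nonempty ι] {z z' c : ι → ℝ} {ε : ℝ}
    (hz : ∀ i, |z i - z' i| ≤ ε) (hc : ∀ i, |c i| ≤ 1) :
    |∑ i, (softmax z i - softmax z' i) * c i| ≤ ε := by
  -- Linear interpolation of the logits from `z'` to `z`; `N t / S t` is the mean of `c` under the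
  -- softmax at time `t`.
  set E : ℝ → ι → ℝ := fun t i => Real.exp (z' i + t * (z i - z' i)) with hE
  set S : ℝ → ℝ := fun t => ∑ i, E t i with hS
  set N : ℝ → ℝ := fun t => ∑ i, E t i * c i with hN
  have hEpos : ∀ t i, 0 < E t i := fun t i => Real.exp_pos _
  have hSpos : ∀ t, 0 < S t := fun t => sum_exp_pos _
  have dE : ∀ t i, HasDerivAt (fun t => E t i) (E t i * (z i - z' i)) t := fun t i => by
    have := (((hasDerivAt_id t).mul_const (z i - z' i)).const_add (z' i)).exp
    simpa using this
  have dS : ∀ t, HasDerivAt S (∑ i, E t i * (z i - z' i)) t := fun t =>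
    HasDerivAt.fun_sum fun i _ => dE t i
  have dN : ∀ t, HasDerivAt N (∑ i, E t i * (z i - z' i) * c i) t := fun t =>
    HasDerivAt.fun_sum fun i _ => (dE t i).mul_const (c i)
  -- The derivative of the mean is the covariance of `c` and `z - z'`, hence at most `ε` times the
  -- mean absolute deviation of `c`.
  have key : ∀ t, |((∑ i, E t i * (z i - z' i) * c i) * S t
      - N t * ∑ i, E t i * (z i - z' i)) / S t ^ 2| ≤ ε := by
    intro t
    have hε : 0 ≤ ε := (abs_nonneg _).trans (hz (Classical.arbitrary ι))
    rw [abs_div, abs_of_pos (pow_pos (hSpos t) 2), div_le_iff₀ (pow_pos (hSpos t) 2)]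
    have e : (∑ i, E t i * (z i - z' i) * c i) * S t - N t * ∑ i, E t i * (z i - z' i)
        = ∑ i, E t i * (z i - z' i) * (c i * S t - N t) := by
      rw [Finset.sum_mul, Finset.mul_sum, ← Finset.sum_sub_distrib]
      exact Finset.sum_congr rfl fun i _ => by ring
    rw [e]
    -- Mean absolute deviation at most one: `2 |x| S ≤ x² + S²` reduces it to the variance, which is
    -- at most the second moment of `c`.
    have h1 : ∑ i, E t i * |c i * S t - N t| ≤ S t ^ 2 := by
      have hs := hSpos t
      have h2 : ∀ i, E t i * |c i * S t - N t| * (2 * S t)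
          ≤ E t i * c i ^ 2 * S t ^ 2 - 2 * (S t * N t) * (E t i * c i) + N t ^ 2 * E t i
            + E t i * S t ^ 2 := fun i => by
        have h6 := mul_nonneg (hEpos t i).le (sq_nonneg (|c i * S t - N t| - S t))
        rw [sub_sq, sq_abs] at h6
        linarith
      have h3 := Finset.sum_le_sum fun i (_ : i ∈ Finset.univ) => h2 i
      rw [← Finset.sum_mul, Finset.sum_add_distrib, Finset.sum_add_distrib, Finset.sum_sub_distrib,
        ← Finset.sum_mul, ← Finset.mul_sum, ← Finset.mul_sum, ← Finset.sum_mul] at h3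
      have h4 : ∑ i, E t i * c i ^ 2 ≤ S t := Finset.sum_le_sum fun i _ => by
        have : c i ^ 2 ≤ 1 := (sq_le_one_iff_abs_le_one _).2 (hc i)
        nlinarith [hEpos t i]
      change (∑ i, E t i * |c i * S t - N t|) * (2 * S t) ≤ (∑ i, E t i * c i ^ 2) * S t ^ 2
        - 2 * (S t * N t) * N t + N t ^ 2 * S t + S t * S t ^ 2 at h3
      have h5 : (∑ i, E t i * |c i * S t - N t|) * (2 * S t) ≤ S t ^ 2 * (2 * S t) := by
        nlinarith [mul_le_mul_of_nonneg_right h4 (sq_nonneg (S t)),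
          mul_nonneg (sq_nonneg (N t)) hs.le]
      exact le_of_mul_le_mul_right h5 (by positivity)
    calc _ ≤ ∑ i, |E t i * (z i - z' i) * (c i * S t - N t)| := Finset.abs_sum_le_sum_abs _ _
      _ ≤ ∑ i, ε * (E t i * |c i * S t - N t|) := Finset.sum_le_sum fun i _ => by
          rw [abs_mul, abs_mul, abs_of_pos (hEpos t i)]
          have := mul_le_mul_of_nonneg_right (hz i)
            (mul_nonneg (hEpos t i).le (abs_nonneg (c i * S t - N t)))
          linarith
      _ ≤ _ := by rw [← Finset.mul_sum]; exact mul_le_mul_of_nonneg_left h1 hε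
  have mv := norm_image_sub_le_of_norm_deriv_le_segment_01' (f := fun t => N t / S t) (C := ε)
    (fun t _ => ((dN t).div (dS t) (hSpos t).ne').hasDerivWithinAt) (fun t _ => key t)
  have e1 : N 1 / S 1 - N 0 / S 0 = ∑ i, (softmax z i - softmax z' i) * c i := by
    simp only [hN, hS, hE, softmax, one_mul, zero_mul, add_zero, add_sub_cancel]
    rw [Finset.sum_div, Finset.sum_div, ← Finset.sum_sub_distrib]
    exact Finset.sum_congr rfl fun i _ => by ring
  rw [e1] at mv
  exact mv

/-- Relative entropy of softmax distributions with nearby logits. -/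
theorem sum_softmax_mul_log_sub_le_sq [Nonempty ι] {z z' : ι → ℝ} {ε : ℝ} (hε : ε ≤ 1)
    (hz : ∀ i, |z i - z' i| ≤ ε) :
    ∑ i, softmax z i * (Real.log (softmax z i) - Real.log (softmax z' i)) ≤ ε ^ 2 := by
  set w : ι → ℝ := fun i => z' i - z i with hw
  have hs := sum_exp_pos z
  have hratio : (∑ j, Real.exp (z' j)) / (∑ j, Real.exp (z j))
      = ∑ i, softmax z i * Real.exp (w i) := by
    rw [Finset.sum_div]
    refine Finset.sum_congr rfl fun i _ => ?_
    rw [softmax, hw, div_mul_eq_mul_div, ← Real.exp_add, add_sub_cancel]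
  -- The relative entropy is `log E[e^w] - E[w]`. Using `log x ≤ x - 1` and `e^w ≤ 1 + w + w²` for
  -- `|w| ≤ 1`, the terms of order zero and one cancel.
  have hlog : Real.log (∑ j, Real.exp (z' j)) - Real.log (∑ j, Real.exp (z j))
      ≤ ∑ i, softmax z i * Real.exp (w i) - 1 := by
    rw [← Real.log_div (sum_exp_pos z').ne' hs.ne', hratio]
    refine Real.log_le_sub_one_of_pos ?_
    rw [← hratio]
    exact div_pos (sum_exp_pos z') hs
  have hterm : ∀ i, softmax z i * (Real.log (softmax z i) - Real.log (softmax z' i))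
      = (Real.log (∑ j, Real.exp (z' j)) - Real.log (∑ j, Real.exp (z j))) * softmax z i
        - softmax z i * w i := fun i => by
    rw [log_softmax, log_softmax, hw]; ring
  simp_rw [hterm]
  rw [Finset.sum_sub_distrib, ← Finset.mul_sum, sum_softmax, mul_one]
  have hexp : ∀ i, softmax z i * Real.exp (w i) ≤ softmax z i + softmax z i * w i
      + ε ^ 2 * softmax z i := fun i => by
    have h1 : |w i| ≤ ε := by rw [hw, abs_sub_comm]; exact hz i
    have h2 := (abs_le.1 (Real.abs_exp_sub_one_sub_id_le (h1.trans hε))).2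
    have h3 : w i ^ 2 ≤ ε ^ 2 := sq_le_sq' (abs_le.1 h1).1 (abs_le.1 h1).2
    nlinarith [softmax_nonneg z i]
  have := Finset.sum_le_sum fun i (_ : i ∈ Finset.univ) => hexp i
  rw [Finset.sum_add_distrib, Finset.sum_add_distrib, ← Finset.mul_sum, sum_softmax] at this
  linarith

/-- One `ε` comes from the logit and one from the normalizing constant. No smallness is needed, so
this serves the short horizons. -/
theorem sum_softmax_mul_log_sub_le [Nonempty ι] {z z' : ι → ℝ} {ε : ℝ}
    (hz : ∀ i, |z i - z' i| ≤ ε) :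
    ∑ i, softmax z i * (Real.log (softmax z i) - Real.log (softmax z' i)) ≤ 2 * ε := by
  have hlog : Real.log (∑ j, Real.exp (z' j)) - Real.log (∑ j, Real.exp (z j)) ≤ ε := by
    rw [sub_le_iff_le_add]
    refine (Real.log_le_log (sum_exp_pos z') ?_).trans
      (le_of_eq (?_ : Real.log (Real.exp ε * ∑ j, Real.exp (z j)) = _))
    · rw [Finset.mul_sum]
      refine Finset.sum_le_sum fun i _ => ?_
      rw [← Real.exp_add]
      exact Real.exp_le_exp.2 (by linarith [(abs_le.1 (hz i)).1])
    · rw [Real.log_mul (Real.exp_pos _).ne' (sum_exp_pos z).ne', Real.log_exp]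
  calc _ ≤ ∑ i, softmax z i * (2 * ε) := Finset.sum_le_sum fun i _ =>
        mul_le_mul_of_nonneg_left (by
          rw [log_softmax, log_softmax]; linarith [(abs_le.1 (hz i)).2]) (softmax_nonneg z i)
    _ = 2 * ε := by rw [← Finset.sum_mul, sum_softmax, one_mul]

end Softmax

/-! ### Radial projection onto the unit ball -/

section Clip

variable {E : Type*} [NormedAddCommGroup E] [InnerProductSpace ℝ E]

/-- The projection of a vector onto the closed unit ball. -/
def clipVec (x : E) : E := (max 1 ‖x‖)⁻¹ • x

theorem norm_clipVec_le (x : E) : ‖clipVec x‖ ≤ 1 := by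
  have h : 0 < max 1 ‖x‖ := lt_max_of_lt_left one_pos
  rw [clipVec, norm_smul, norm_inv, Real.norm_of_nonneg h.le, inv_mul_le_iff₀ h, mul_one]
  exact le_max_right _ _

/-- The variational inequality of a metric projection: the residual is a nonnegative multiple of
`clipVec x`, and it vanishes inside the ball. -/
theorem inner_sub_clipVec_nonpos (x : E) {y : E} (hy : ‖y‖ ≤ 1) :
    inner ℝ (x - clipVec x) (y - clipVec x) ≤ 0 := by
  have h : 0 < max 1 ‖x‖ := lt_max_of_lt_left one_pos
  have hx : x - clipVec x = (max 1 ‖x‖ - 1) • clipVec x := by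
    rw [sub_smul, one_smul, clipVec, smul_smul, mul_inv_cancel₀ h.ne', one_smul]
  rw [hx, inner_smul_left, inner_sub_right, real_inner_self_eq_norm_sq]
  simp only [conj_trivial]
  rcases le_total ‖x‖ 1 with h1 | h1
  · rw [max_eq_left h1]; simp
  · have h2 : ‖clipVec x‖ = 1 := by
      rw [clipVec, max_eq_right h1, norm_smul, norm_inv, norm_norm, inv_mul_cancel₀]
      linarith
    have h3 := real_inner_le_norm (clipVec x) y
    rw [h2] at h3 ⊢
    rw [max_eq_right h1]
    nlinarith

/-- Adding the variational inequalities at `x` and `y` gives firm nonexpansiveness, and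
Cauchy–Schwarz finishes. -/
theorem norm_clipVec_sub_le (x y : E) : ‖clipVec x - clipVec y‖ ≤ ‖x - y‖ := by
  have h1 := inner_sub_clipVec_nonpos x (norm_clipVec_le y)
  have h2 := inner_sub_clipVec_nonpos y (norm_clipVec_le x)
  set a := clipVec x
  set b := clipVec y
  have h3 : ‖a - b‖ ^ 2 ≤ inner ℝ (x - y) (a - b) := by
    rw [← real_inner_self_eq_norm_sq]
    simp only [inner_sub_left, inner_sub_right, real_inner_comm] at h1 h2 ⊢
    linarith [real_inner_comm a x, real_inner_comm b x, real_inner_comm a y, real_inner_comm b y,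
      real_inner_comm a b]
  have h4 := real_inner_le_norm (x - y) (a - b)
  rcases (norm_nonneg (a - b)).eq_or_lt with h | h
  · rw [← h]; exact norm_nonneg _
  · exact le_of_mul_le_mul_right (by nlinarith) h

end Clip

/-! ### Perturbation of the network -/

/-- A column of a matrix as a vector of the Euclidean space. -/
def col {m n : ℕ} (U : Matrix (Fin m) (Fin n) ℝ) (j : Fin n) : EuclideanSpace ℝ (Fin m) :=
  WithLp.toLp 2 fun i => U i j

/-- A row of a matrix as a vector of the Euclidean space. -/
def row {m n : ℕ} (M : Matrix (Fin m) (Fin n) ℝ) (i : Fin m) : EuclideanSpace ℝ (Fin n) :=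
  WithLp.toLp 2 (M i)

/-- The action of a matrix on the Euclidean space. -/
def act {m n : ℕ} (M : Matrix (Fin m) (Fin n) ℝ) :
    EuclideanSpace ℝ (Fin n) →L[ℝ] EuclideanSpace ℝ (Fin m) :=
  (Matrix.toEuclideanLin.trans LinearMap.toContinuousLinearMap) M

theorem act_sub {m n : ℕ} (M M' : Matrix (Fin m) (Fin n) ℝ) : act (M - M') = act M - act M' :=
  map_sub _ M M'

theorem act_apply {m n : ℕ} (M : Matrix (Fin m) (Fin n) ℝ) (x : EuclideanSpace ℝ (Fin n))
    (i : Fin m) : act M x i = ∑ k, M i k * x k := rfl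

theorem act_apply_eq_inner {m n : ℕ} (M : Matrix (Fin m) (Fin n) ℝ)
    (x : EuclideanSpace ℝ (Fin n)) (i : Fin m) : act M x i = inner ℝ (row M i) x := by
  rw [act_apply]
  simp [PiLp.inner_apply, row, mul_comm]

theorem norm_act_sq {m n : ℕ} (M : Matrix (Fin m) (Fin n) ℝ) (x : EuclideanSpace ℝ (Fin n)) :
    ‖act M x‖ ^ 2 = ∑ i, (inner ℝ (row M i) x) ^ 2 := by
  rw [EuclideanSpace.norm_sq_eq]
  simp only [act_apply_eq_inner, Real.norm_eq_abs, sq_abs]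

theorem norm_act_le_of_row_le {m n : ℕ} {M : Matrix (Fin m) (Fin n) ℝ} {ρ : ℝ}
    (hρ : 0 ≤ ρ) (h : ∀ i, ‖row M i‖ ≤ ρ) : ‖act M‖ ≤ Real.sqrt m * ρ := by
  refine ContinuousLinearMap.opNorm_le_bound _ (by positivity) fun x => ?_
  refine abs_le_of_sq_le_sq' ?_ (by positivity) |>.2
  rw [norm_act_sq, mul_pow, mul_pow, Real.sq_sqrt m.cast_nonneg]
  calc _ ≤ ∑ _i : Fin m, ρ ^ 2 * ‖x‖ ^ 2 := Finset.sum_le_sum fun i _ => by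
        rw [← mul_pow, ← sq_abs]
        refine pow_le_pow_left₀ (abs_nonneg _) ((abs_real_inner_le_norm _ _).trans ?_) 2
        exact mul_le_mul_of_nonneg_right (h i) (norm_nonneg _)
    _ = _ := by simp [mul_assoc]

theorem norm_row_le_of_entry_le {m n : ℕ} {M : Matrix (Fin m) (Fin n) ℝ} {ρ : ℝ}
    (hρ : 0 ≤ ρ) (h : ∀ i j, |M i j| ≤ ρ) (i : Fin m) : ‖row M i‖ ≤ Real.sqrt n * ρ := by
  refine abs_le_of_sq_le_sq' ?_ (by positivity) |>.2
  rw [EuclideanSpace.norm_sq_eq, mul_pow, Real.sq_sqrt n.cast_nonneg]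
  calc _ ≤ ∑ _j : Fin n, ρ ^ 2 := Finset.sum_le_sum fun j _ => by
        rw [Real.norm_eq_abs]
        exact pow_le_pow_left₀ (abs_nonneg _) (h i j) 2
    _ = _ := by simp

theorem norm_act_le_of_entry_le {n : ℕ} {M : Matrix (Fin n) (Fin n) ℝ} {ρ : ℝ}
    (hρ : 0 ≤ ρ) (h : ∀ i j, |M i j| ≤ ρ) : ‖act M‖ ≤ n * ρ := by
  refine (norm_act_le_of_row_le (by positivity) (norm_row_le_of_entry_le hρ h)).trans (le_of_eq ?_)
  rw [← mul_assoc, Real.mul_self_sqrt n.cast_nonneg]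

/-- The attention-weighted average of the columns of `U`. -/
def attn {r n : ℕ} (A : Matrix (Fin r) (Fin r) ℝ) (U : Matrix (Fin r) (Fin n) ℝ) (j : Fin n) :
    EuclideanSpace ℝ (Fin r) :=
  ∑ k, attention A U k j • col U k

theorem attention_eq {r n : ℕ} (A : Matrix (Fin r) (Fin r) ℝ) (U : Matrix (Fin r) (Fin n) ℝ)
    (k j : Fin n) : attention A U k j
      = softmax (fun k' => (Real.sqrt r)⁻¹ * inner ℝ (col U k') (act A (col U j))) k := by
  simp only [attention, colSoftmax, Matrix.of_apply]
  congr 1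
  ext k'
  simp only [Matrix.smul_apply, smul_eq_mul, Matrix.mul_assoc, PiLp.inner_apply]
  congr 1
  simp only [Matrix.mul_apply, Matrix.transpose_apply, act_apply, col, RCLike.inner_apply,
    conj_trivial]
  exact Finset.sum_congr rfl fun i _ => mul_comm _ _

theorem col_clip {m n : ℕ} (M : Matrix (Fin m) (Fin n) ℝ) (j : Fin n) :
    col (clip M) j = clipVec (col M j) := by
  ext i
  simp only [col, clip, clipVec, Matrix.of_apply, PiLp.smul_apply, smul_eq_mul,
    EuclideanSpace.norm_eq, Real.norm_eq_abs, sq_abs]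
  rw [div_eq_inv_mul]

/-- Multiplication by the attention matrix averages columns, so a layer acts column by column:
average, apply `V`, project. -/
theorem col_layer {m r n : ℕ} (A : Matrix (Fin r) (Fin r) ℝ) (V : Matrix (Fin m) (Fin r) ℝ)
    (U : Matrix (Fin r) (Fin n) ℝ) (j : Fin n) :
    col (layer A V U) j = clipVec (act V (attn A U j)) := by
  rw [layer, col_clip]
  congr 1
  ext i
  simp only [col, attn, act_apply, Matrix.mul_apply, WithLp.ofLp_sum, WithLp.ofLp_smul,
    Finset.sum_apply, Pi.smul_apply, smul_eq_mul, Finset.mul_sum, Finset.sum_mul]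
  rw [Finset.sum_comm]
  exact Finset.sum_congr rfl fun k _ => Finset.sum_congr rfl fun l _ => by ring

theorem norm_col_layer_le {m r n : ℕ} (A : Matrix (Fin r) (Fin r) ℝ) (V : Matrix (Fin m) (Fin r) ℝ)
    (U : Matrix (Fin r) (Fin n) ℝ) (j : Fin n) : ‖col (layer A V U) j‖ ≤ 1 := by
  rw [col_layer]
  exact norm_clipVec_le _

theorem norm_sum_smul_le {ι E : Type*} [Fintype ι] [NormedAddCommGroup E] [NormedSpace ℝ E]
    {p : ι → ℝ} (hp : ∀ i, 0 ≤ p i) (hp1 : ∑ i, p i = 1) {u : ι → E} {D : ℝ}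
    (hu : ∀ i, ‖u i‖ ≤ D) : ‖∑ i, p i • u i‖ ≤ D := by
  calc _ ≤ ∑ i, p i * D := (norm_sum_le _ _).trans (Finset.sum_le_sum fun i _ => by
        rw [norm_smul, Real.norm_of_nonneg (hp i)]
        exact mul_le_mul_of_nonneg_left (hu i) (hp i))
    _ = D := by rw [← Finset.sum_mul, hp1, one_mul]

/-- Pairing the sum `s` with `s / ‖s‖` reduces the vector bound to the scalar one with test
functions bounded by one. -/
theorem norm_sum_softmax_sub_smul_le {ι E : Type*} [Fintype ι] [Nonempty ι]
    [NormedAddCommGroup E] [InnerProductSpace ℝ E] {z z' : ι → ℝ} {ε : ℝ}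
    (hz : ∀ i, |z i - z' i| ≤ ε) {u : ι → E} (hu : ∀ i, ‖u i‖ ≤ 1) :
    ‖∑ i, (softmax z i - softmax z' i) • u i‖ ≤ ε := by
  set s := ∑ i, (softmax z i - softmax z' i) • u i with hs
  rcases (norm_nonneg s).eq_or_lt with h | h
  · rw [← h]
    exact (abs_nonneg _).trans (hz (Classical.arbitrary ι))
  · have hc : ∀ i, |inner ℝ (u i) s / ‖s‖| ≤ 1 := fun i => by
      rw [abs_div, abs_norm, div_le_one h]
      refine (abs_real_inner_le_norm _ _).trans ?_
      exact mul_le_of_le_one_left h.le (hu i)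
    have := (le_abs_self _).trans (abs_sum_softmax_sub_mul_le hz hc)
    have e : ∑ i, (softmax z i - softmax z' i) * (inner ℝ (u i) s / ‖s‖) = ‖s‖ := by
      have h1 : inner ℝ s s = ∑ i, (softmax z i - softmax z' i) * inner ℝ (u i) s := by
        conv_lhs => rw [hs, sum_inner]
        exact Finset.sum_congr rfl fun i _ => by rw [real_inner_smul_left, hs]
      rw [real_inner_self_eq_norm_sq] at h1
      simp_rw [← mul_div_assoc]
      rw [← Finset.sum_div, ← h1, sq, mul_div_assoc, div_self h.ne', mul_one]
    rwa [e] at this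

/-! ### Lipschitz estimates for a single layer -/

section LayerPerturbation

variable {m r n : ℕ} {A A' : Matrix (Fin r) (Fin r) ℝ} {V V' : Matrix (Fin m) (Fin r) ℝ}
  {U U' : Matrix (Fin r) (Fin n) ℝ}

theorem norm_attn_le_one (hU : ∀ j, ‖col U j‖ ≤ 1) (j : Fin n) : ‖attn A U j‖ ≤ 1 := by
  have : Nonempty (Fin n) := ⟨j⟩
  simp only [attn, attention_eq]
  exact norm_sum_smul_le (softmax_nonneg _) (sum_softmax _) hU

/-- The scores are bilinear in the columns: changing either column costs `‖act A‖ * D`, changing the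
matrix costs `‖act (A - A')‖`. The remaining `D` is an average of column differences. The number of
columns never enters. -/
theorem norm_attn_sub_le (hU : ∀ j, ‖col U j‖ ≤ 1) (hU' : ∀ j, ‖col U' j‖ ≤ 1) {D : ℝ}
    (hD : ∀ j, ‖col U j - col U' j‖ ≤ D) (j : Fin n) :
    ‖attn A U j - attn A' U' j‖ ≤ (1 + 2 * ((Real.sqrt r)⁻¹ * ‖act A‖)) * D
      + (Real.sqrt r)⁻¹ * ‖act (A - A')‖ := by
  have : Nonempty (Fin n) := ⟨j⟩
  set z := fun k' => (Real.sqrt r)⁻¹ * inner ℝ (col U k') (act A (col U j)) with hz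
  set z' := fun k' => (Real.sqrt r)⁻¹ * inner ℝ (col U' k') (act A' (col U' j)) with hz'
  have hD0 : 0 ≤ D := (norm_nonneg _).trans (hD j)
  have hzz : ∀ k, |z k - z' k|
      ≤ (Real.sqrt r)⁻¹ * (2 * ‖act A‖ * D + ‖act (A - A')‖) := by
    intro k
    have e : z k - z' k = (Real.sqrt r)⁻¹ * (inner ℝ (col U k - col U' k) (act A (col U j))
        + inner ℝ (col U' k) (act A (col U j - col U' j))
        + inner ℝ (col U' k) (act (A - A') (col U' j))) := by
      rw [hz, hz', act_sub, sub_apply, map_sub]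
      simp only [inner_sub_left, inner_sub_right]
      ring
    rw [e, abs_mul, abs_of_nonneg (by positivity : 0 ≤ (Real.sqrt r)⁻¹)]
    refine mul_le_mul_of_nonneg_left ?_ (by positivity)
    have b1 : |inner ℝ (col U k - col U' k) (act A (col U j))| ≤ D * ‖act A‖ :=
      (abs_real_inner_le_norm _ _).trans (mul_le_mul (hD k)
        ((act A).le_of_opNorm_le_of_le le_rfl (hU j) |>.trans (mul_one _).le)
        (norm_nonneg _) hD0)
    have b2 : |inner ℝ (col U' k) (act A (col U j - col U' j))| ≤ 1 * (‖act A‖ * D) :=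
      (abs_real_inner_le_norm _ _).trans (mul_le_mul (hU' k)
        ((act A).le_of_opNorm_le_of_le le_rfl (hD j)) (norm_nonneg _) zero_le_one)
    have b3 : |inner ℝ (col U' k) (act (A - A') (col U' j))| ≤ 1 * ‖act (A - A')‖ :=
      (abs_real_inner_le_norm _ _).trans (mul_le_mul (hU' k)
        ((act (A - A')).le_of_opNorm_le_of_le le_rfl (hU' j) |>.trans (mul_one _).le)
        (norm_nonneg _) zero_le_one)
    refine (abs_add_three _ _ _).trans ?_
    linarith
  have e : attn A U j - attn A' U' j
      = ∑ k, (softmax z k - softmax z' k) • col U k + ∑ k, softmax z' k • (col U k - col U' k) := by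
    simp only [attn, attention_eq, ← hz, ← hz']
    rw [← Finset.sum_add_distrib, ← Finset.sum_sub_distrib]
    exact Finset.sum_congr rfl fun k _ => by rw [sub_smul, smul_sub]; abel
  rw [e]
  refine (norm_add_le _ _).trans ((add_le_add (norm_sum_softmax_sub_smul_le hzz hU)
    (norm_sum_smul_le (softmax_nonneg z') (sum_softmax z') hD)).trans (le_of_eq ?_))
  ring

/-- An entrywise error `ρ` in `A` has operator norm at most `r ρ`, reduced to `√r ρ` by the scaling
of the scores; a rowwise error `ρ` in `V` has operator norm at most `√m ρ`. -/
theorem norm_col_layer_sub_le (hU : ∀ j, ‖col U j‖ ≤ 1) (hU' : ∀ j, ‖col U' j‖ ≤ 1) {D v b ρ : ℝ}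
    (hD : ∀ j, ‖col U j - col U' j‖ ≤ D) (hv : ‖act V‖ ≤ v)
    (hb : 1 + 2 * ((Real.sqrt r)⁻¹ * ‖act A‖) ≤ b) (hρ : 0 ≤ ρ)
    (hA : ∀ i j, |A i j - A' i j| ≤ ρ) (hV : ∀ i, ‖row (V - V') i‖ ≤ ρ) (j : Fin n) :
    ‖col (layer A V U) j - col (layer A' V' U') j‖
      ≤ v * b * D + (v * Real.sqrt r + Real.sqrt m) * ρ := by
  have hD0 : 0 ≤ D := (norm_nonneg _).trans (hD j)
  have hA' : (Real.sqrt r)⁻¹ * ‖act (A - A')‖ ≤ Real.sqrt r * ρ := by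
    have := norm_act_le_of_entry_le (M := A - A') hρ hA
    refine (mul_le_mul_of_nonneg_left this (by positivity)).trans (le_of_eq ?_)
    rw [← mul_assoc, ← div_eq_inv_mul, Real.div_sqrt]
  rw [col_layer, col_layer]
  refine (norm_clipVec_sub_le _ _).trans ?_
  have e : act V (attn A U j) - act V' (attn A' U' j)
      = act V (attn A U j - attn A' U' j) + act (V - V') (attn A' U' j) := by
    rw [act_sub, sub_apply, map_sub]
    abel
  rw [e]
  have h1 : ‖act V (attn A U j - attn A' U' j)‖ ≤ v * (b * D + Real.sqrt r * ρ) :=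
    (act V).le_of_opNorm_le_of_le hv ((norm_attn_sub_le hU hU' hD j).trans
      (add_le_add (mul_le_mul_of_nonneg_right hb hD0) hA'))
  have h2 : ‖act (V - V') (attn A' U' j)‖ ≤ Real.sqrt m * ρ * 1 :=
    (act (V - V')).le_of_opNorm_le_of_le (norm_act_le_of_row_le hρ hV) (norm_attn_le_one hU' j)
  refine (norm_add_le _ _).trans ((add_le_add h1 h2).trans (le_of_eq ?_))
  ring

end LayerPerturbation

/-- Propagation of errors through a composition of maps, with weights `R` that absorb the Lipschitz
constants `τ`. -/
theorem foldl_dist_le {α : Type*} (G : α → Prop) (D : α → α → ℝ) {c : ℝ} :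
    ∀ (n : ℕ) (f f' : α → Fin n → α) (τ e : Fin n → ℝ) (R : Fin (n + 1) → ℝ)
      (_ : ∀ l, 0 ≤ R l) (_ : ∀ x l, G x → G (f x l)) (_ : ∀ x l, G x → G (f' x l))
      (_ : ∀ x y l, G x → G y → D (f x l) (f' y l) ≤ τ l * D x y + e l)
      (_ : ∀ l, R l.castSucc = τ l * R l.succ) (_ : ∀ l, e l * R l.succ ≤ c)
      (x y : α) (_ : G x) (_ : G y),
      (G (Fin.foldl n f x) ∧ G (Fin.foldl n f' y)) ∧
      D (Fin.foldl n f x) (Fin.foldl n f' y) * R (Fin.last n) ≤ D x y * R 0 + n * c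
  | 0, f, f', τ, e, R, hR, hf, hf', hD, hτ, he, x, y, hx, hy => by
    simpa using ⟨hx, hy⟩
  | n + 1, f, f', τ, e, R, hR, hf, hf', hD, hτ, he, x, y, hx, hy => by
    rw [Fin.foldl_succ, Fin.foldl_succ]
    obtain ⟨h1, h2⟩ := foldl_dist_le G D n (fun x i => f x i.succ) (fun x i => f' x i.succ)
      (fun i => τ i.succ) (fun i => e i.succ) (fun i => R i.succ) (fun _ => hR _)
      (fun _ _ => hf _ _) (fun _ _ => hf' _ _) (fun _ _ _ => hD _ _ _) (fun l => hτ l.succ)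
      (fun _ => he _) (f x 0) (f' y 0) (hf _ _ hx) (hf' _ _ hy)
    refine ⟨h1, h2.trans ?_⟩
    have h3 := mul_le_mul_of_nonneg_right (hD x y 0 hx hy) (hR (Fin.succ 0))
    have h4 := hτ 0
    have h5 := he 0
    rw [Fin.castSucc_zero] at h4
    push_cast
    rw [h4]
    linarith

/-- Both networks start from the same input, so only injected errors count. Each hidden layer adds
at most `c` after amplification by the later ones; the last layer is separate because its output has
`d` rows. -/
theorem abs_output_sub_le {d r L n : ℕ} {θ θ' : Weights d r L}
    {U : Matrix (Fin r) (Fin n) ℝ} (hU : ∀ j, ‖col U j‖ ≤ 1)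
    {v b ρ : Fin (L - 1) → ℝ} {v' b' ρ' c : ℝ} {R : Fin (L - 1 + 1) → ℝ} (hR0 : ∀ l, 0 ≤ R l)
    (hv : ∀ l, ‖act (Matrix.of (θ.1 l).2)‖ ≤ v l)
    (hb : ∀ l, 1 + 2 * ((Real.sqrt r)⁻¹ * ‖act (Matrix.of (θ.1 l).1)‖) ≤ b l)
    (hρ : ∀ l, 0 ≤ ρ l)
    (hA : ∀ l i j, |(θ.1 l).1 i j - (θ'.1 l).1 i j| ≤ ρ l)
    (hV : ∀ l i, ‖row (Matrix.of (θ.1 l).2 - Matrix.of (θ'.1 l).2) i‖ ≤ ρ l)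
    (hv' : ‖act (Matrix.of θ.2.2)‖ ≤ v')
    (hb' : 1 + 2 * ((Real.sqrt r)⁻¹ * ‖act (Matrix.of θ.2.1)‖) ≤ b')
    (hρ' : 0 ≤ ρ')
    (hA' : ∀ i j, |θ.2.1 i j - θ'.2.1 i j| ≤ ρ')
    (hV' : ∀ i, ‖row (Matrix.of θ.2.2 - Matrix.of θ'.2.2) i‖ ≤ ρ')
    (hRlast : R (Fin.last _) = v' * b') (hR : ∀ l, R l.castSucc = v l * b l * R l.succ)
    (hc : ∀ l, (v l * Real.sqrt r + Real.sqrt r) * ρ l * R l.succ ≤ c) (i : Fin d) (j : Fin n) :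
    |output θ U i j - output θ' U i j|
      ≤ (L - 1 : ℕ) * c + (v' * Real.sqrt r + Real.sqrt d) * ρ' := by
  have key := foldl_dist_le (α := Matrix (Fin r) (Fin n) ℝ) (c := c) (fun U => ∀ j, ‖col U j‖ ≤ 1)
    (fun U U' => ‖fun j => col U j - col U' j‖) (L - 1)
    (fun U' l => layer (Matrix.of (θ.1 l).1) (Matrix.of (θ.1 l).2) U')
    (fun U' l => layer (Matrix.of (θ'.1 l).1) (Matrix.of (θ'.1 l).2) U')
    (fun l => v l * b l) (fun l => (v l * Real.sqrt r + Real.sqrt r) * ρ l) R hR0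
    (fun _ _ _ => norm_col_layer_le _ _ _) (fun _ _ _ => norm_col_layer_le _ _ _)
    (fun x y l hx hy => by
      have hv0 : 0 ≤ v l := (norm_nonneg _).trans (hv l)
      have hb0 : 0 ≤ b l := le_trans (by positivity) (hb l)
      have hρ0 := hρ l
      refine (pi_norm_le_iff_of_nonneg (by positivity)).2 fun j => ?_
      exact norm_col_layer_sub_le hx hy
        (fun j => norm_le_pi_norm (fun j => col x j - col y j) j) (hv l) (hb l) (hρ l) (hA l)
        (hV l) j) hR hc U U hU hU
  obtain ⟨⟨g1, g2⟩, key⟩ := key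
  set W := Fin.foldl (L - 1)
    (fun U' l => layer (Matrix.of (θ.1 l).1) (Matrix.of (θ.1 l).2) U') U with hW
  set W' := Fin.foldl (L - 1)
    (fun U' l => layer (Matrix.of (θ'.1 l).1) (Matrix.of (θ'.1 l).2) U') U with hW'
  have h0 : ‖fun j => col U j - col U j‖ = 0 := by
    rw [norm_eq_zero]; ext j; simp
  simp only [h0, zero_mul, zero_add] at key
  have fin := norm_col_layer_sub_le g1 g2
    (fun j => norm_le_pi_norm (fun j => col W j - col W' j) j) hv' hb' hρ' hA' hV' j
  have h1 : |output θ U i j - output θ' U i j| ≤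
      ‖col (layer (Matrix.of θ.2.1) (Matrix.of θ.2.2) W) j
        - col (layer (Matrix.of θ'.2.1) (Matrix.of θ'.2.2) W') j‖ :=
    PiLp.norm_apply_le (col (layer (Matrix.of θ.2.1) (Matrix.of θ.2.2) W) j
        - col (layer (Matrix.of θ'.2.1) (Matrix.of θ'.2.2) W') j) i
  refine h1.trans (fin.trans ?_)
  rw [hRlast] at key
  linarith

theorem abs_output_le_one {d r L n : ℕ} (θ : Weights d r L) (U : Matrix (Fin r) (Fin n) ℝ)
    (i : Fin d) (j : Fin n) : |output θ U i j| ≤ 1 :=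
  (PiLp.norm_apply_le (col (output θ U) j) i).trans (norm_col_layer_le _ _ _ j)

theorem norm_col_contextEmbedding {d r : ℕ} (K : ℕ) {Φ : Fin d → EuclideanSpace ℝ (Fin r)}
    (hΦ : ∀ j, ‖Φ j‖ = 1) (t : ℕ) (x : Fin (t + 1) → Fin d) (j) :
    ‖col (contextEmbedding K Φ t x) j‖ ≤ 1 :=
  (hΦ _).le

/-! ### Exponential moments of Gaussian and spherical marginals -/

/-- The exponent `3/8` is chosen so that the value `(1 - 2 * 3/8)^(-1/2)` is exactly `2`. -/
theorem lintegral_exp_sq_gaussianReal :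
    ∫⁻ x, ENNReal.ofReal (Real.exp (3 / 8 * x ^ 2)) ∂(gaussianReal 0 1) = 2 := by
  rw [gaussianReal_of_var_ne_zero 0 one_ne_zero,
    lintegral_withDensity_eq_lintegral_mul _ (measurable_gaussianPDF 0 1) (by fun_prop)]
  have e : ∀ x : ℝ, (gaussianPDF 0 1 * fun x => ENNReal.ofReal (Real.exp (3 / 8 * x ^ 2))) x
      = ENNReal.ofReal ((Real.sqrt (2 * Real.pi))⁻¹ * Real.exp (-(1 / 8) * x ^ 2)) := fun x => by
    rw [Pi.mul_apply, gaussianPDF, ← ENNReal.ofReal_mul (gaussianPDFReal_nonneg _ _ _),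
      gaussianPDFReal, mul_assoc, ← Real.exp_add]
    congr 3
    · simp
    · simp only [sub_zero, NNReal.coe_one]
      ring
  simp_rw [e]
  have hi : Integrable fun x : ℝ => (Real.sqrt (2 * Real.pi))⁻¹ * Real.exp (-(1 / 8) * x ^ 2) :=
    (integrable_exp_neg_mul_sq (by norm_num)).const_mul _
  rw [← ofReal_integral_eq_lintegral_ofReal hi (.of_forall fun x => by positivity),
    integral_const_mul, integral_gaussian,
    show Real.pi / (1 / 8) = 2 ^ 2 * (2 * Real.pi) by ring, Real.sqrt_mul (by norm_num) (2 * Real.pi),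
    Real.sqrt_sq (by norm_num), mul_left_comm, inv_mul_cancel₀ (by positivity), mul_one]
  simp

section Euclidean

variable {r : ℕ}

theorem lintegral_polar (hr : 0 < r) {F : EuclideanSpace ℝ (Fin r) → ENNReal}
    (hF : Measurable F) :
    ∫⁻ x, F x = ∫⁻ v : Metric.sphere (0 : EuclideanSpace ℝ (Fin r)) 1,
      ∫⁻ ρ in Set.Ioi (0 : ℝ), ENNReal.ofReal (ρ ^ (r - 1)) * F (ρ • v.1)
      ∂volume ∂(volume : Measure (EuclideanSpace ℝ (Fin r))).toSphere := by
  have : Nonempty (Fin r) := ⟨⟨0, hr⟩⟩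
  have hmp := (volume : Measure (EuclideanSpace ℝ (Fin r))).measurePreserving_homeomorphUnitSphereProd
  rw [finrank_euclideanSpace_fin] at hmp
  have h1 := (hmp.symm (homeomorphUnitSphereProd
    (EuclideanSpace ℝ (Fin r))).toMeasurableEquiv).lintegral_comp_emb
    (MeasurableEquiv.measurableEmbedding _) (fun x => F x.1)
  rw [lintegral_subtype_comap (measurableSet_singleton _).compl, restrict_compl_singleton] at h1
  rw [← h1]
  have hm : Measurable fun z : Metric.sphere (0 : EuclideanSpace ℝ (Fin r)) 1 × Set.Ioi (0 : ℝ) =>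
      F (z.2.1 • z.1.1) :=
    hF.comp ((measurable_subtype_coe.comp measurable_snd).smul
      (measurable_subtype_coe.comp measurable_fst))
  refine Eq.trans (lintegral_prod
    (fun z : Metric.sphere (0 : EuclideanSpace ℝ (Fin r)) 1 × Set.Ioi (0 : ℝ) =>
      F (z.2.1 • z.1.1)) hm.aemeasurable) ?_
  refine lintegral_congr fun v => ?_
  have hv : Measurable fun ρ : Set.Ioi (0 : ℝ) => F (ρ.1 • v.1) := hm.comp measurable_prodMk_left
  refine Eq.trans (lintegral_withDensity_eq_lintegral_mul _ (by fun_prop) hv) ?_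
  exact lintegral_subtype_comap measurableSet_Ioi
    (fun ρ => ENNReal.ofReal (ρ ^ (r - 1)) * F (ρ • v.1))

theorem lintegral_radial_gaussian (hr : 0 < r) {b : ℝ} (hb : 0 < b) :
    ∫⁻ ρ in Set.Ioi (0 : ℝ), ENNReal.ofReal (ρ ^ (r - 1)) * ENNReal.ofReal (Real.exp (-b * ρ ^ 2))
      = ENNReal.ofReal (b ^ (-(r : ℝ) / 2)) * ENNReal.ofReal (1 / 2 * Real.Gamma (r / 2)) := by
  have hq : (-1 : ℝ) < (r : ℝ) - 1 := by
    have : (0 : ℝ) < r := Nat.cast_pos.2 hr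
    linarith
  have e : ∀ ρ ∈ Set.Ioi (0 : ℝ),
      ENNReal.ofReal (ρ ^ (r - 1)) * ENNReal.ofReal (Real.exp (-b * ρ ^ 2))
      = ENNReal.ofReal (ρ ^ ((r : ℝ) - 1) * Real.exp (-b * ρ ^ (2 : ℝ))) := fun ρ hρ => by
    rw [← ENNReal.ofReal_mul (pow_nonneg (le_of_lt hρ) _), Real.rpow_two, ← Real.rpow_natCast,
      Nat.cast_sub hr, Nat.cast_one]
  rw [setLIntegral_congr_fun measurableSet_Ioi e, ← ofReal_integral_eq_lintegral_ofReal
    (integrableOn_rpow_mul_exp_neg_mul_rpow hq two_pos hb)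
    ((ae_restrict_mem measurableSet_Ioi).mono fun ρ hρ =>
      mul_nonneg (Real.rpow_nonneg (le_of_lt hρ) _) (Real.exp_pos _).le),
    integral_rpow_mul_exp_neg_mul_rpow two_pos hq hb, ← ENNReal.ofReal_mul (by positivity)]
  congr 1
  rw [sub_add_cancel, mul_assoc]

/-- Write `exp (3/4 s²)` as the Gaussian mean of `exp (k s g)` with `k² = 3/2`, exchange the
integrals and complete the square. The translation by `(k g / 2) u` leaves the factor `exp (3/8
g²)`, of mean `2`. -/
theorem lintegral_exp_neg_sq_add_inner_sq {u : EuclideanSpace ℝ (Fin r)} (hu : ‖u‖ = 1) :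
    ∫⁻ x : EuclideanSpace ℝ (Fin r),
      ENNReal.ofReal (Real.exp (-‖x‖ ^ 2 + 3 / 4 * inner ℝ x u ^ 2))
      = 2 * ∫⁻ x : EuclideanSpace ℝ (Fin r), ENNReal.ofReal (Real.exp (-‖x‖ ^ 2)) := by
  set k : ℝ := Real.sqrt (3 / 2) with hk
  have hk2 : k ^ 2 = 3 / 2 := Real.sq_sqrt (by norm_num)
  have h1 : ∀ x : EuclideanSpace ℝ (Fin r),
      ENNReal.ofReal (Real.exp (-‖x‖ ^ 2 + 3 / 4 * inner ℝ x u ^ 2))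
      = ∫⁻ g, ENNReal.ofReal (Real.exp (-‖x‖ ^ 2 + k * inner ℝ x u * g)) ∂(gaussianReal 0 1) := by
    intro x
    have h2 : ∫ g, Real.exp (-‖x‖ ^ 2 + k * inner ℝ x u * g) ∂(gaussianReal 0 1)
        = Real.exp (-‖x‖ ^ 2 + 3 / 4 * inner ℝ x u ^ 2) := by
      have h3 := congrFun (mgf_id_gaussianReal (μ := 0) (v := 1)) (k * inner ℝ x u)
      simp only [mgf, id] at h3
      simp_rw [Real.exp_add]
      rw [integral_const_mul, h3]
      congr 2
      simp only [zero_mul, NNReal.coe_one, zero_add, one_mul]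
      rw [mul_pow, hk2]
      ring
    rw [← h2, ofReal_integral_eq_lintegral_ofReal _ (.of_forall fun _ => (Real.exp_pos _).le)]
    simp_rw [Real.exp_add]
    exact (integrable_exp_mul_gaussianReal _).const_mul _
  simp_rw [h1]
  rw [lintegral_lintegral_swap (by
    simp only [Function.uncurry_def]; fun_prop)]
  have h4 : ∀ g : ℝ, ∫⁻ x : EuclideanSpace ℝ (Fin r),
      ENNReal.ofReal (Real.exp (-‖x‖ ^ 2 + k * inner ℝ x u * g))
      = ENNReal.ofReal (Real.exp (3 / 8 * g ^ 2))
        * ∫⁻ x : EuclideanSpace ℝ (Fin r), ENNReal.ofReal (Real.exp (-‖x‖ ^ 2)) := by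
    intro g
    rw [← lintegral_add_right_eq_self _ ((k * g / 2) • u), ← lintegral_const_mul _ (by fun_prop)]
    refine lintegral_congr fun x => ?_
    rw [← ENNReal.ofReal_mul (Real.exp_pos _).le, ← Real.exp_add]
    congr 2
    rw [norm_add_sq_real, inner_add_left, real_inner_smul_left, real_inner_smul_right,
      real_inner_self_eq_norm_sq, norm_smul, mul_pow, hu, Real.norm_eq_abs, sq_abs]
    linear_combination (g ^ 2 / 4) * hk2
  simp_rw [h4]
  rw [lintegral_mul_const _ (by fun_prop), lintegral_exp_sq_gaussianReal]

/-- In polar coordinates the direction `v`, with `s = ⟨v, u⟩`, contributes `(1 - 3/4 s²)^(-r/2)`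
times the radial constant; since `log (1 - y) ≤ -y`, this is at least `exp (3/8 r s²)` times it. So
the Gaussian integral dominates the spherical one. -/
theorem lintegral_toSphere_exp_inner_sq_le (hr : 0 < r) {u : EuclideanSpace ℝ (Fin r)}
    (hu : ‖u‖ = 1) :
    ∫⁻ v : Metric.sphere (0 : EuclideanSpace ℝ (Fin r)) 1,
        ENNReal.ofReal (Real.exp (3 / 8 * (r * inner ℝ v.1 u ^ 2)))
        ∂(volume : Measure (EuclideanSpace ℝ (Fin r))).toSphere
      ≤ 2 * (volume : Measure (EuclideanSpace ℝ (Fin r))).toSphere Set.univ := by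
  set J := ENNReal.ofReal (1 / 2 * Real.Gamma (r / 2)) with hJ
  have hr' : (0 : ℝ) < r := Nat.cast_pos.2 hr
  have hJ0 : J ≠ 0 := by
    have := Real.Gamma_pos_of_pos (half_pos hr')
    rw [hJ, ne_eq, ENNReal.ofReal_eq_zero, not_le]
    positivity
  have h := lintegral_exp_neg_sq_add_inner_sq hu
  rw [lintegral_polar hr (by fun_prop), lintegral_polar hr (by fun_prop)] at h
  have e2 : ∀ v : Metric.sphere (0 : EuclideanSpace ℝ (Fin r)) 1,
      ∫⁻ ρ in Set.Ioi (0 : ℝ), ENNReal.ofReal (ρ ^ (r - 1)) *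
        ENNReal.ofReal (Real.exp (-‖ρ • v.1‖ ^ 2)) = J := by
    intro v
    have hv : ‖v.1‖ = 1 := by simp
    have := lintegral_radial_gaussian hr one_pos
    rw [Real.one_rpow, ENNReal.ofReal_one, one_mul] at this
    rw [hJ, ← this]
    refine lintegral_congr fun ρ => ?_
    rw [norm_smul, hv, mul_one, Real.norm_eq_abs, sq_abs, neg_one_mul]
  have e1 : ∀ v : Metric.sphere (0 : EuclideanSpace ℝ (Fin r)) 1,
      ENNReal.ofReal (Real.exp (3 / 8 * (r * inner ℝ v.1 u ^ 2))) * J ≤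
      ∫⁻ ρ in Set.Ioi (0 : ℝ), ENNReal.ofReal (ρ ^ (r - 1)) *
        ENNReal.ofReal (Real.exp (-‖ρ • v.1‖ ^ 2 + 3 / 4 * inner ℝ (ρ • v.1) u ^ 2)) := by
    intro v
    have hv : ‖v.1‖ = 1 := by simp
    set s : ℝ := inner ℝ v.1 u with hs
    have hs1 : s ^ 2 ≤ 1 := by
      rw [sq_le_one_iff_abs_le_one]
      have := abs_real_inner_le_norm v.1 u
      rwa [hv, hu, one_mul] at this
    have hb : 0 < 1 - 3 / 4 * s ^ 2 := by linarith
    have := lintegral_radial_gaussian hr hb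
    have e3 : ∀ ρ : ℝ, -‖ρ • v.1‖ ^ 2 + 3 / 4 * inner ℝ (ρ • v.1) u ^ 2
        = -(1 - 3 / 4 * s ^ 2) * ρ ^ 2 := fun ρ => by
      rw [norm_smul, hv, mul_one, Real.norm_eq_abs, sq_abs, real_inner_smul_left, ← hs]
      ring
    simp_rw [e3]
    rw [this]
    refine mul_le_mul_left ?_ J
    refine ENNReal.ofReal_le_ofReal ?_
    rw [Real.rpow_def_of_pos hb, Real.exp_le_exp]
    have h5 := Real.log_le_sub_one_of_pos hb
    nlinarith
  simp_rw [e2] at h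
  rw [lintegral_const] at h
  have h6 := lintegral_mono (μ := (volume : Measure (EuclideanSpace ℝ (Fin r))).toSphere) e1
  rw [h, lintegral_mul_const _ (by fun_prop), mul_comm J, ← mul_assoc] at h6
  exact (ENNReal.mul_le_mul_iff_left hJ0 ENNReal.ofReal_ne_top).1 h6

theorem toSphere_univ_ne_zero (hr : 0 < r) :
    (volume : Measure (EuclideanSpace ℝ (Fin r))).toSphere Set.univ ≠ 0 := by
  have : Nonempty (Fin r) := ⟨⟨0, hr⟩⟩
  rw [ne_eq, Measure.measure_univ_eq_zero]
  exact Measure.toSphere_ne_zero _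

theorem measurable_ofLp_sphere : Measurable
    fun x : Metric.sphere (0 : EuclideanSpace ℝ (Fin r)) 1 => WithLp.ofLp x.1 := by
  fun_prop

theorem isProbabilityMeasure_uniformSphere (hr : 0 < r) :
    IsProbabilityMeasure (uniformSphere r) := by
  refine ⟨?_⟩
  rw [uniformSphere, Measure.map_apply measurable_ofLp_sphere .univ, Set.preimage_univ,
    Measure.smul_apply, smul_eq_mul]
  exact ENNReal.inv_mul_cancel (toSphere_univ_ne_zero hr) (measure_ne_top _ _)

theorem lintegral_uniformSphere_exp_inner_sq_le (hr : 0 < r) {y : EuclideanSpace ℝ (Fin r)}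
    (hy : ‖y‖ ≤ 1) :
    ∫⁻ v, ENNReal.ofReal (Real.exp (3 / 8 * (r * inner ℝ (WithLp.toLp 2 v) y ^ 2)))
      ∂(uniformSphere r) ≤ 2 := by
  have := isProbabilityMeasure_uniformSphere hr
  rcases eq_or_ne y 0 with rfl | h0
  · simp
  set u := ‖y‖⁻¹ • y with hu
  have hu1 : ‖u‖ = 1 := by
    rw [hu, norm_smul, norm_inv, norm_norm, inv_mul_cancel₀ (norm_ne_zero_iff.2 h0)]
  have hyu : y = ‖y‖ • u := by rw [hu, smul_smul, mul_inv_cancel₀ (norm_ne_zero_iff.2 h0), one_smul]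
  calc _ ≤ ∫⁻ v, ENNReal.ofReal (Real.exp (3 / 8 * (r * inner ℝ (WithLp.toLp 2 v) u ^ 2)))
      ∂(uniformSphere r) := by
        refine lintegral_mono fun v => ENNReal.ofReal_le_ofReal (Real.exp_le_exp.2 ?_)
        rw [hyu, real_inner_smul_right, mul_pow]
        have : ‖y‖ ^ 2 ≤ 1 := pow_le_one₀ (norm_nonneg _) hy
        have h3 : ‖y‖ ^ 2 * inner ℝ (WithLp.toLp 2 v) u ^ 2 ≤ inner ℝ (WithLp.toLp 2 v) u ^ 2 :=
          mul_le_of_le_one_left (sq_nonneg _) this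
        gcongr
    _ ≤ 2 := by
        rw [uniformSphere, lintegral_map (by fun_prop) measurable_ofLp_sphere,
          lintegral_smul_measure, smul_eq_mul]
        refine (mul_le_mul_right (lintegral_toSphere_exp_inner_sq_le hr hu1) _).trans (le_of_eq ?_)
        rw [mul_left_comm, ENNReal.inv_mul_cancel (toSphere_univ_ne_zero hr) (measure_ne_top _ _),
          mul_one]

/-- After rescaling to a unit direction, the marginal of the standard Gaussian is one-dimensional
standard Gaussian. -/
theorem lintegral_gaussian_exp_inner_sq_le {y : EuclideanSpace ℝ (Fin r)} (hy : ‖y‖ ≤ 1) :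
    ∫⁻ v, ENNReal.ofReal (Real.exp (3 / 8 * inner ℝ (WithLp.toLp 2 v) y ^ 2))
      ∂(Measure.pi fun _ : Fin r => gaussianReal 0 1) ≤ 2 := by
  rcases eq_or_ne y 0 with rfl | h0
  · simp
  set u := ‖y‖⁻¹ • y with hu
  have hu1 : ‖u‖ = 1 := by
    rw [hu, norm_smul, norm_inv, norm_norm, inv_mul_cancel₀ (norm_ne_zero_iff.2 h0)]
  have hyu : y = ‖y‖ • u := by rw [hu, smul_smul, mul_inv_cancel₀ (norm_ne_zero_iff.2 h0), one_smul]
  calc _ ≤ ∫⁻ v, ENNReal.ofReal (Real.exp (3 / 8 * inner ℝ (WithLp.toLp 2 v) u ^ 2))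
      ∂(Measure.pi fun _ : Fin r => gaussianReal 0 1) := by
        refine lintegral_mono fun v => ENNReal.ofReal_le_ofReal (Real.exp_le_exp.2 ?_)
        rw [hyu, real_inner_smul_right, mul_pow]
        have : ‖y‖ ^ 2 ≤ 1 := pow_le_one₀ (norm_nonneg _) hy
        have h3 : ‖y‖ ^ 2 * inner ℝ (WithLp.toLp 2 v) u ^ 2 ≤ inner ℝ (WithLp.toLp 2 v) u ^ 2 :=
          mul_le_of_le_one_left (sq_nonneg _) this
        gcongr
    _ = ∫⁻ x, ENNReal.ofReal (Real.exp (3 / 8 * x ^ 2)) ∂(gaussianReal 0 1) := by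
        have hlaw : (stdGaussian (EuclideanSpace ℝ (Fin r))).map (innerSL ℝ u)
            = gaussianReal 0 1 := by
          rw [IsGaussian.map_eq_gaussianReal, integral_strongDual_stdGaussian,
            variance_dual_stdGaussian, innerSL_apply_norm, hu1]
          simp
        conv_rhs => rw [← hlaw, lintegral_map (by fun_prop) (by fun_prop),
          ← map_pi_eq_stdGaussian, lintegral_map (by fun_prop) (by fun_prop)]
        refine lintegral_congr fun v => ?_
        rw [innerSL_apply_apply, real_inner_comm]
    _ ≤ 2 := lintegral_exp_sq_gaussianReal.le

end Euclidean

/-! ### Second moment of the operator norm of a random matrix -/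

section OperatorNorm

variable {r : ℕ}

theorem continuous_act_apply {m n : ℕ} : Continuous
    fun p : Entries m n × EuclideanSpace ℝ (Fin n) => act (Matrix.of p.1) p.2 := by
  have : Continuous fun p : Entries m n × EuclideanSpace ℝ (Fin n) =>
      (WithLp.toLp 2 (fun i => ∑ k, p.1 i k * p.2 k) : EuclideanSpace ℝ (Fin m)) := by
    fun_prop
  exact this

theorem continuous_norm_act {m n : ℕ} : Continuous
    fun a : Entries m n => ‖act (Matrix.of a)‖ := by
  have h : Continuous ((Matrix.toEuclideanLin.trans LinearMap.toContinuousLinearMap :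
    Matrix (Fin m) (Fin n) ℝ ≃ₗ[ℝ] _) : Matrix (Fin m) (Fin n) ℝ →ₗ[ℝ]
      (EuclideanSpace ℝ (Fin n) →L[ℝ] EuclideanSpace ℝ (Fin m))) :=
    LinearMap.continuous_of_finiteDimensional _
  exact (h.comp (continuous_id : Continuous fun a : Entries m n => (Matrix.of a))).norm

theorem inner_act_transpose {m n : ℕ} (M : Matrix (Fin m) (Fin n) ℝ)
    (x : EuclideanSpace ℝ (Fin m)) (y : EuclideanSpace ℝ (Fin n)) :
    inner ℝ (act Mᵀ x) y = inner ℝ x (act M y) := by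
  simp only [PiLp.inner_apply, act_apply, RCLike.inner_apply, conj_trivial, Matrix.transpose_apply,
    Finset.mul_sum, Finset.sum_mul]
  rw [Finset.sum_comm]
  exact Finset.sum_congr rfl fun i _ => Finset.sum_congr rfl fun j _ => by ring

open scoped Matrix.Norms.L2Operator in
theorem norm_act_transpose {m n : ℕ} (M : Matrix (Fin m) (Fin n) ℝ) : ‖act Mᵀ‖ = ‖act M‖ := by
  have := Matrix.l2_opNorm_conjTranspose M
  rwa [Matrix.conjTranspose_eq_transpose_of_trivial, Matrix.l2_opNorm_def,
    Matrix.l2_opNorm_def] at this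

/-- An average over the unit ball controls the operator norm. -/
theorem exp_norm_act_le_lintegral_ball (hr : 0 < r) {κ : ℝ} (hκ : 0 ≤ κ)
    (M : Matrix (Fin r) (Fin r) ℝ) {u : EuclideanSpace ℝ (Fin r)} (hu : ‖u‖ = 1) :
    ENNReal.ofReal (Real.exp (κ * (9 / 16 * ‖act Mᵀ u‖ ^ 2)) * (1 / 8) ^ r) *
        volume (Metric.ball (0 : EuclideanSpace ℝ (Fin r)) 1)
      ≤ ∫⁻ y in Metric.ball (0 : EuclideanSpace ℝ (Fin r)) 1,
        ENNReal.ofReal (Real.exp (κ * ‖act M y‖ ^ 2)) := by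
  have : Nonempty (Fin r) := ⟨⟨0, hr⟩⟩
  set w := act Mᵀ u with hw
  -- For `w = 0` this is `0`, and all that follows remains valid.
  set e : EuclideanSpace ℝ (Fin r) := ‖w‖⁻¹ • w with he
  have he1 : ‖e‖ ≤ 1 := by
    rw [he, norm_smul, norm_inv, norm_norm]
    exact inv_mul_le_one
  have hwe : inner ℝ w e = ‖w‖ := by
    rw [he, real_inner_smul_right, real_inner_self_eq_norm_sq, sq, ← mul_assoc]
    rcases eq_or_ne ‖w‖ 0 with h | h
    · simp [h]
    · rw [inv_mul_cancel₀ h, one_mul]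
  have hsub : Metric.ball ((7 / 8 : ℝ) • e) (1 / 8) ⊆ Metric.ball 0 1 := by
    refine Metric.ball_subset_ball' ?_
    rw [dist_zero_right, norm_smul, Real.norm_of_nonneg (by norm_num)]
    linarith
  calc _ = ∫⁻ _y in Metric.ball ((7 / 8 : ℝ) • e) (1 / 8),
        ENNReal.ofReal (Real.exp (κ * (9 / 16 * ‖w‖ ^ 2))) := by
        rw [lintegral_const, Measure.restrict_apply_univ,
          Measure.addHaar_ball volume ((7 / 8 : ℝ) • e) (by norm_num : (0 : ℝ) ≤ 1 / 8),
          finrank_euclideanSpace_fin, ENNReal.ofReal_mul (Real.exp_pos _).le, mul_assoc]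
    _ ≤ ∫⁻ y in Metric.ball ((7 / 8 : ℝ) • e) (1 / 8),
        ENNReal.ofReal (Real.exp (κ * ‖act M y‖ ^ 2)) := by
        refine setLIntegral_mono' measurableSet_ball fun y hy => ?_
        refine ENNReal.ofReal_le_ofReal (Real.exp_le_exp.2 (mul_le_mul_of_nonneg_left ?_ hκ))
        rw [Metric.mem_ball, dist_eq_norm] at hy
        have h1 : inner ℝ w y = 7 / 8 * ‖w‖ + inner ℝ w (y - (7 / 8 : ℝ) • e) := by
          rw [inner_sub_right, real_inner_smul_right, hwe]
          ring
        have h2 : -(‖w‖ * (1 / 8)) ≤ inner ℝ w (y - (7 / 8 : ℝ) • e) := by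
          have := (abs_le.1 (abs_real_inner_le_norm w (y - (7 / 8 : ℝ) • e))).1
          have := mul_le_mul_of_nonneg_left hy.le (norm_nonneg w)
          linarith
        have h3 : inner ℝ w y ≤ ‖act M y‖ := by
          rw [hw, inner_act_transpose]
          refine (real_inner_le_norm _ _).trans ?_
          rw [hu, one_mul]
        -- On the small ball the pairing with `w` loses at most `1/8` from `7/8`; the square of
        -- `3/4` is the `9/16` of the statement.
        have h4 : 3 / 4 * ‖w‖ ≤ ‖act M y‖ := by linarith
        have h5 := pow_le_pow_left₀ (by positivity) h4 2
        linarith [mul_pow (3 / 4) ‖w‖ 2]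
    _ ≤ _ := lintegral_mono_set hsub

/-- Exponential moments of `‖M y‖²` for fixed unit vectors `y` bound the second moment of the
operator norm of `M`. -/
theorem integral_norm_act_sq_le (hr : 0 < r) {κ : ℝ} (hκ : 0 < κ) {ν : Measure (Entries r r)}
    [IsProbabilityMeasure ν]
    (h : ∀ y : EuclideanSpace ℝ (Fin r), ‖y‖ ≤ 1 →
      ∫⁻ a, ENNReal.ofReal (Real.exp (κ * ‖act (Matrix.of a) y‖ ^ 2)) ∂ν ≤ 2 ^ r) :
    Integrable (fun a => ‖act (Matrix.of a)‖ ^ 2) ν ∧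
      κ * (9 / 16) * ∫ a, ‖act (Matrix.of a)‖ ^ 2 ∂ν ≤ r * Real.log 16 := by
  have : Nonempty (Fin r) := ⟨⟨0, hr⟩⟩
  set vol : ENNReal := volume (Metric.ball (0 : EuclideanSpace ℝ (Fin r)) 1) with hvol
  have hvol0 : vol ≠ 0 := (Metric.measure_ball_pos _ _ one_pos).ne'
  have hvolt : vol ≠ ⊤ := measure_ball_lt_top.ne
  set Z : Entries r r → ENNReal := fun a => ∫⁻ y in Metric.ball (0 : EuclideanSpace ℝ (Fin r)) 1,
    ENNReal.ofReal (Real.exp (κ * ‖act (Matrix.of a) y‖ ^ 2)) with hZ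
  have hmeas : Measurable fun p : Entries r r × EuclideanSpace ℝ (Fin r) =>
      ENNReal.ofReal (Real.exp (κ * ‖act (Matrix.of p.1) p.2‖ ^ 2)) :=
    ((Real.continuous_exp.comp (continuous_const.mul
      (continuous_act_apply.norm.pow 2))).measurable).ennreal_ofReal
  have hZm : Measurable Z := hmeas.lintegral_prod_right'
  have hZint : ∫⁻ a, Z a ∂ν ≤ 2 ^ r * vol := by
    rw [hZ, lintegral_lintegral_swap hmeas.aemeasurable]
    refine (setLIntegral_mono' measurableSet_ball (g := fun _ => (2 : ENNReal) ^ r)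
      fun y hy => h y ?_).trans ?_
    · rw [Metric.mem_ball, dist_zero_right] at hy
      exact hy.le
    · rw [lintegral_const, Measure.restrict_apply_univ]
  set z : Entries r r → ENNReal := fun a => Z a / vol with hz
  have hzm : Measurable z := hZm.div_const _
  have hzint : ∫⁻ a, z a ∂ν ≤ 2 ^ r := by
    simp only [hz, div_eq_mul_inv]
    rw [lintegral_mul_const _ hZm]
    refine (mul_le_mul_left hZint _).trans ?_
    rw [mul_assoc, ENNReal.mul_inv_cancel hvol0 hvolt, mul_one]
  have hzfin : ∫⁻ a, z a ∂ν ≠ ⊤ := (hzint.trans_lt (by finiteness)).ne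
  have hzae := ae_lt_top hzm hzfin
  have hzI : Integrable (fun a => (z a).toReal) ν :=
    integrable_toReal_of_lintegral_ne_top hzm.aemeasurable hzfin
  have hzE : ∫ a, (z a).toReal ∂ν ≤ 2 ^ r := by
    rw [integral_toReal hzm.aemeasurable hzae]
    have := ENNReal.toReal_mono (by finiteness) hzint
    simpa using this
  set k : ℝ := κ * (9 / 16) with hk
  have hk0 : 0 < k := by positivity
  -- The small ball costs `8^r`, and `log z` is linearized at `2^r`, whence `16 = 8 * 2`. The `-1`
  -- offsets the mean of `z / 2^r`, which is at most one.
  have hpt : ∀ᵐ a ∂ν, k * ‖act (Matrix.of a)‖ ^ 2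
      ≤ r * Real.log 16 - 1 + (z a).toReal / 2 ^ r := by
    filter_upwards [hzae] with a ha
    have h1 : ∀ u : EuclideanSpace ℝ (Fin r), ‖u‖ = 1 →
        k * ‖act (Matrix.of a)ᵀ u‖ ^ 2 ≤ r * Real.log 16 - 1 + (z a).toReal / 2 ^ r := by
      intro u hu
      have h2 := exp_norm_act_le_lintegral_ball hr hκ.le (Matrix.of a) hu
      have h3 : ENNReal.ofReal (Real.exp (κ * (9 / 16 * ‖act (Matrix.of a)ᵀ u‖ ^ 2)) * (1 / 8) ^ r)
          ≤ z a := by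
        rw [hz]
        exact (ENNReal.le_div_iff_mul_le (.inl hvol0) (.inl hvolt)).2 h2
      have h4 := (ENNReal.ofReal_le_iff_le_toReal ha.ne).1 h3
      rw [← mul_assoc, ← hk] at h4
      set x := k * ‖act (Matrix.of a)ᵀ u‖ ^ 2 with hx
      have h5 : 0 < Real.exp x * (1 / 8) ^ r := by positivity
      have h6 := Real.log_le_sub_one_of_pos (x := (z a).toReal / 2 ^ r)
        (div_pos (h5.trans_le h4) (by positivity))
      have h7 := Real.log_le_log h5 h4
      rw [Real.log_mul (Real.exp_pos _).ne' (by positivity), Real.log_exp, Real.log_pow] at h7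
      rw [Real.log_div (h5.trans_le h4).ne' (by positivity), Real.log_pow] at h6
      have h8 : Real.log (1 / 8) = -(3 * Real.log 2) := by
        rw [one_div, Real.log_inv, show (8 : ℝ) = 2 ^ 3 by norm_num, Real.log_pow]
        norm_num
      have h9 : Real.log 16 = 4 * Real.log 2 := by
        rw [show (16 : ℝ) = 2 ^ 4 by norm_num, Real.log_pow]
        norm_num
      rw [h8] at h7
      rw [h9]
      linarith
    set B := r * Real.log 16 - 1 + (z a).toReal / 2 ^ r with hB
    have hB0 : 0 ≤ B / k := by
      have := h1 (EuclideanSpace.single ⟨0, hr⟩ 1) (by simp)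
      exact div_nonneg ((by positivity : (0 : ℝ) ≤ _).trans this) hk0.le
    have h10 : ‖act (Matrix.of a)ᵀ‖ ≤ Real.sqrt (B / k) := by
      refine ContinuousLinearMap.opNorm_le_of_unit_norm (Real.sqrt_nonneg _) fun u hu => ?_
      refine Real.le_sqrt_of_sq_le ?_
      rw [le_div_iff₀ hk0, mul_comm]
      exact h1 u hu
    rw [norm_act_transpose] at h10
    have h11 := pow_le_pow_left₀ (norm_nonneg _) h10 2
    rw [Real.sq_sqrt hB0, le_div_iff₀ hk0] at h11
    linarith
  have hbI : Integrable (fun a => r * Real.log 16 - 1 + (z a).toReal / 2 ^ r) ν :=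
    (integrable_const _).add (hzI.div_const _)
  have hI : Integrable (fun a => k * ‖act (Matrix.of a)‖ ^ 2) ν := by
    refine hbI.mono' ((continuous_norm_act.pow 2).const_mul k).aestronglyMeasurable ?_
    filter_upwards [hpt] with a ha
    rwa [Real.norm_of_nonneg (by positivity)]
  have hI' : Integrable (fun a => ‖act (Matrix.of a)‖ ^ 2) ν := by
    have := hI.const_mul k⁻¹
    simpa only [inv_mul_cancel_left₀ hk0.ne'] using this
  refine ⟨hI', ?_⟩
  rw [← integral_const_mul]
  refine (integral_mono_ae hI hbI hpt).trans ?_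
  rw [integral_add (integrable_const _) (hzI.div_const _), integral_div]
  simp only [integral_const, probReal_univ, one_smul]
  have : (∫ a, (z a).toReal ∂ν) / 2 ^ r ≤ 1 := (div_le_one (by positivity)).2 hzE
  linarith

/-- `‖M y‖²` is a sum over independent rows, so its exponential moment is a product of `r` factors,
each at most `2`. -/
theorem lintegral_exp_norm_act_sq_le {ν : Measure (Fin r → ℝ)} [IsProbabilityMeasure ν] {κ : ℝ}
    {y : EuclideanSpace ℝ (Fin r)}
    (h : ∫⁻ v, ENNReal.ofReal (Real.exp (κ * inner ℝ (WithLp.toLp 2 v) y ^ 2)) ∂ν ≤ 2) :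
    ∫⁻ a : Entries r r, ENNReal.ofReal (Real.exp (κ * ‖act (Matrix.of a) y‖ ^ 2))
      ∂(Measure.pi fun _ => ν) ≤ 2 ^ r := by
  set F : (Fin r → ℝ) → ENNReal := fun v =>
    ENNReal.ofReal (Real.exp (κ * inner ℝ (WithLp.toLp 2 v) y ^ 2)) with hF
  have hFm : Measurable F := by fun_prop
  have e : ∀ a : Entries r r, ENNReal.ofReal (Real.exp (κ * ‖act (Matrix.of a) y‖ ^ 2))
      = ∏ i, F (a i) := fun a => by
    rw [norm_act_sq, Finset.mul_sum, Real.exp_sum,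
      ENNReal.ofReal_prod_of_nonneg fun _ _ => (Real.exp_pos _).le]
    rfl
  simp_rw [e]
  have hind := iIndepFun_pi (μ := fun _ : Fin r => ν) (X := fun _ => F)
    (fun _ => hFm.aemeasurable)
  rw [lintegral_prod_eq_prod_lintegral_of_indepFun Finset.univ (fun i (a : Entries r r) => F (a i))
    hind (fun i => hFm.comp (measurable_pi_apply i))]
  calc _ ≤ ∏ _i : Fin r, (2 : ENNReal) := Finset.prod_le_prod' fun i _ => by
        refine le_trans (le_of_eq ?_) h
        exact (measurePreserving_eval (fun _ : Fin r => ν) i).lintegral_comp hFm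
    _ = 2 ^ r := by simp

theorem log_sixteen_le : Real.log 16 ≤ 2.7728 := by
  rw [show (16 : ℝ) = 2 ^ 4 by norm_num, Real.log_pow]
  have := Real.log_two_lt_d9
  norm_num
  linarith

/-- The admissible exponent `3/8 * r` grows with `r` and cancels the factor `r` of the general
bound, which makes the constant dimension-free. -/
theorem integral_norm_act_sq_sphericalRows_le (hr : 0 < r) :
    Integrable (fun a => ‖act (Matrix.of a)‖ ^ 2) (sphericalRows r r) ∧
      ∫ a, ‖act (Matrix.of a)‖ ^ 2 ∂(sphericalRows r r) ≤ 66 / 5 := by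
  have := isProbabilityMeasure_uniformSphere hr
  have hr' : (0 : ℝ) < r := Nat.cast_pos.2 hr
  have : IsProbabilityMeasure (sphericalRows r r) := by rw [sphericalRows]; infer_instance
  obtain ⟨h1, h2⟩ := integral_norm_act_sq_le (κ := 3 / 8 * r) (ν := sphericalRows r r) hr
    (by positivity) fun y hy => lintegral_exp_norm_act_sq_le (by
      simpa only [mul_assoc] using lintegral_uniformSphere_exp_inner_sq_le hr hy)
  refine ⟨h1, ?_⟩
  have h3 := log_sixteen_le
  have h4 : 3 / 8 * (9 / 16) * ∫ a, ‖act (Matrix.of a)‖ ^ 2 ∂(sphericalRows r r) ≤ Real.log 16 :=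
    le_of_mul_le_mul_left (by linarith) hr'
  linarith

theorem integral_norm_act_sq_gaussianEntries_le (hr : 0 < r) :
    Integrable (fun a => ((Real.sqrt r)⁻¹ * ‖act (Matrix.of a)‖) ^ 2) (gaussianEntries r r) ∧
      ∫ a, ((Real.sqrt r)⁻¹ * ‖act (Matrix.of a)‖) ^ 2 ∂(gaussianEntries r r) ≤ 66 / 5 := by
  have hr' : (0 : ℝ) < r := Nat.cast_pos.2 hr
  have : IsProbabilityMeasure (gaussianEntries r r) := by rw [gaussianEntries]; infer_instance
  obtain ⟨h1, h2⟩ := integral_norm_act_sq_le (κ := 3 / 8) (ν := gaussianEntries r r) hr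
    (by positivity) fun y hy => lintegral_exp_norm_act_sq_le (lintegral_gaussian_exp_inner_sq_le hy)
  simp only [mul_pow, inv_pow, Real.sq_sqrt hr'.le]
  refine ⟨h1.const_mul _, ?_⟩
  rw [integral_const_mul, inv_mul_le_iff₀ hr']
  have h3 := mul_le_mul_of_nonneg_left log_sixteen_le hr'.le
  linarith

end OperatorNorm

/-! ### Small-ball probabilities under the prior -/

theorem exp_neg_add_le_prod_real {α β : Type*} [MeasurableSpace α] [MeasurableSpace β]
    {μ : Measure α} {ν : Measure β} [SFinite ν] {s : Set α} {t : Set β}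
    {a b : ℝ} (hs : Real.exp (-a) ≤ μ.real s) (ht : Real.exp (-b) ≤ ν.real t) :
    Real.exp (-(a + b)) ≤ (μ.prod ν).real (s ×ˢ t) := by
  rw [measureReal_prod_prod, neg_add, Real.exp_add]
  exact mul_le_mul hs ht (Real.exp_pos _).le measureReal_nonneg

theorem exp_neg_sum_le_pi_real {ι : Type*} [Fintype ι] {α : ι → Type*}
    [∀ i, MeasurableSpace (α i)] {μ : ∀ i, Measure (α i)} [∀ i, SigmaFinite (μ i)]
    {s : ∀ i, Set (α i)} {a : ι → ℝ} (hs : ∀ i, Real.exp (-a i) ≤ (μ i).real (s i)) :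
    Real.exp (-∑ i, a i) ≤ (Measure.pi μ).real (Set.univ.pi s) := by
  rw [measureReal_def, Measure.pi_pi, ENNReal.toReal_prod, ← Finset.sum_neg_distrib, Real.exp_sum]
  exact Finset.prod_le_prod (fun _ _ => (Real.exp_pos _).le) fun i _ => hs i

/-- Only the half of the interval running from `a` towards the origin is used: there `x² ≤ a² + 1`,
which bounds the density from below. -/
theorem exp_neg_le_gaussianReal_real {a ρ : ℝ} (hρ : 0 < ρ) (hρ1 : ρ ≤ 1) :
    Real.exp (-(Real.log (2 * Real.pi) / 2 + 1 / 2 + a ^ 2 / 2 - Real.log ρ))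
      ≤ (gaussianReal 0 1).real {x | |a - x| ≤ ρ} := by
  obtain ⟨I, hI, hvol, hsub⟩ : ∃ I : Set ℝ, MeasurableSet I ∧ volume I = ENNReal.ofReal ρ ∧
      ∀ x ∈ I, |a - x| ≤ ρ ∧ x ^ 2 ≤ a ^ 2 + 1 := by
    rcases le_total 0 a with h | h
    · refine ⟨Set.Icc (a - ρ) a, measurableSet_Icc, by simp, fun x hx => ⟨?_, ?_⟩⟩
      · rw [abs_le]; constructor <;> linarith [hx.1, hx.2]
      · nlinarith [hx.1, hx.2, mul_nonneg h (sub_nonneg.2 hx.2)]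
    · refine ⟨Set.Icc a (a + ρ), measurableSet_Icc, by simp, fun x hx => ⟨?_, ?_⟩⟩
      · rw [abs_le]; constructor <;> linarith [hx.1, hx.2]
      · nlinarith [hx.1, hx.2, mul_nonneg (neg_nonneg.2 h) (sub_nonneg.2 hx.1)]
  have h1 : (gaussianReal 0 1).real I ≤ (gaussianReal 0 1).real {x | |a - x| ≤ ρ} :=
    measureReal_mono fun x hx => (hsub x hx).1
  refine le_trans ?_ h1
  set q := (Real.sqrt (2 * Real.pi))⁻¹ * Real.exp (-(a ^ 2 + 1) / 2) with hq
  have h2 : ENNReal.ofReal (q * ρ) ≤ gaussianReal 0 1 I := by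
    rw [gaussianReal_apply 0 one_ne_zero, ENNReal.ofReal_mul (by positivity), ← hvol,
      ← setLIntegral_const]
    refine setLIntegral_mono' hI fun x hx => ?_
    rw [gaussianPDF, gaussianPDFReal]
    refine ENNReal.ofReal_le_ofReal ?_
    simp only [NNReal.coe_one, mul_one, sub_zero]
    refine mul_le_mul_of_nonneg_left (Real.exp_le_exp.2 ?_) (by positivity)
    linarith [(hsub x hx).2]
  have h3 := (ENNReal.ofReal_le_iff_le_toReal (measure_ne_top _ _)).1 h2
  refine le_trans (le_of_eq ?_) h3
  have h4 : (Real.sqrt (2 * Real.pi))⁻¹ = Real.exp (-(Real.log (2 * Real.pi) / 2)) := by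
    rw [Real.exp_neg, Real.sqrt_eq_rpow, Real.rpow_def_of_pos (by positivity)]
    congr 2
    ring
  rw [hq, h4, ← Real.exp_add, show -(Real.log (2 * Real.pi) / 2 + 1 / 2 + a ^ 2 / 2 - Real.log ρ)
    = -(Real.log (2 * Real.pi) / 2) + -(a ^ 2 + 1) / 2 + Real.log ρ by ring, Real.exp_add _
    (Real.log ρ), Real.exp_log hρ]

theorem exp_neg_le_gaussianEntries_real {m n : ℕ} (A : Entries m n) {ρ : ℝ} (hρ : 0 < ρ)
    (hρ1 : ρ ≤ 1) :
    Real.exp (-(m * n * (Real.log (2 * Real.pi) / 2 + 1 / 2 - Real.log ρ)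
        + (∑ i, ∑ j, A i j ^ 2) / 2))
      ≤ (gaussianEntries m n).real (Set.univ.pi fun i => Set.univ.pi fun j =>
        {x | |A i j - x| ≤ ρ}) := by
  have h := exp_neg_sum_le_pi_real (μ := fun _ : Fin m => Measure.pi fun _ : Fin n => gaussianReal 0 1)
    fun i => exp_neg_sum_le_pi_real (μ := fun _ : Fin n => gaussianReal 0 1)
      fun j => exp_neg_le_gaussianReal_real (a := A i j) hρ hρ1
  refine le_trans (le_of_eq ?_) h
  congr 2
  simp only [Finset.sum_add_distrib, Finset.sum_sub_distrib, Finset.sum_const, Finset.card_univ,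
    Fintype.card_fin, nsmul_eq_mul, ← Finset.sum_div]
  ring

/-- A spherical cap of radius `ρ` carries at least the fraction `(ρ / 4)^r` of the surface measure.
-/
theorem exp_neg_le_uniformSphere_real {r : ℕ} (hr : 0 < r) {v : Fin r → ℝ}
    (hv : ‖(WithLp.toLp 2 v : EuclideanSpace ℝ (Fin r))‖ = 1) {ρ : ℝ} (hρ : 0 < ρ) (hρ1 : ρ ≤ 1) :
    Real.exp (-(r * (Real.log 4 - Real.log ρ))) ≤ (uniformSphere r).real
      {w | ‖(WithLp.toLp 2 (v - w) : EuclideanSpace ℝ (Fin r))‖ ≤ ρ} := by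
  have hne : Nonempty (Fin r) := ⟨⟨0, hr⟩⟩
  set μ := (volume : Measure (EuclideanSpace ℝ (Fin r))) with hμ
  set x : Metric.sphere (0 : EuclideanSpace ℝ (Fin r)) 1 := ⟨WithLp.toLp 2 v, by simpa using hv⟩
    with hx
  have h1 := Measure.toSphereBallBound_mul_measure_unitBall_le_toSphere_ball μ hρ x
  have h2 : (Measure.toSphereBallBound (Module.finrank ℝ (EuclideanSpace ℝ (Fin r))) ρ : ENNReal)
      = r * ENNReal.ofReal ((ρ / 4) ^ r) := by
    have hmin : min ρ.toNNReal 2 = ρ.toNNReal := by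
      refine min_eq_left ?_
      rw [Real.toNNReal_le_iff_le_coe]
      exact hρ1.trans (by norm_num)
    rw [Measure.toSphereBallBound, finrank_euclideanSpace_fin, if_pos ⟨hr.ne', hρ⟩, hmin,
      ENNReal.coe_mul, ENNReal.coe_natCast, ENNReal.ofReal]
    congr 2
    rw [Real.toNNReal_pow (by positivity), Real.toNNReal_div hρ.le]
    congr 2
    simp
  have h3 : μ.toSphere Set.univ = r * μ (Metric.ball 0 1) := by
    rw [Measure.toSphere_apply_univ, finrank_euclideanSpace_fin]
  have h4 : ENNReal.ofReal ((ρ / 4) ^ r) * μ.toSphere Set.univ ≤ μ.toSphere (Metric.ball x ρ) := by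
    rw [h3, ← mul_assoc, mul_comm (ENNReal.ofReal _), ← h2]
    exact h1
  have h5 : ENNReal.ofReal ((ρ / 4) ^ r) ≤ uniformSphere r
      {w | ‖(WithLp.toLp 2 (v - w) : EuclideanSpace ℝ (Fin r))‖ ≤ ρ} := by
    have hm : MeasurableSet {w | ‖(WithLp.toLp 2 (v - w) : EuclideanSpace ℝ (Fin r))‖ ≤ ρ} :=
      measurableSet_le (by fun_prop) measurable_const
    rw [uniformSphere, Measure.map_apply measurable_ofLp_sphere hm, Measure.smul_apply, smul_eq_mul,
      mul_comm, ← div_eq_mul_inv, ENNReal.le_div_iff_mul_le (.inl (toSphere_univ_ne_zero hr))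
        (.inl (measure_ne_top _ _))]
    refine h4.trans (measure_mono fun y hy => ?_)
    rw [Metric.mem_ball, dist_comm, Subtype.dist_eq, dist_eq_norm] at hy
    exact hy.le
  have := isProbabilityMeasure_uniformSphere hr
  have h6 := (ENNReal.ofReal_le_iff_le_toReal (measure_ne_top _ _)).1 h5
  refine le_trans (le_of_eq ?_) h6
  rw [← Real.log_div (by norm_num) hρ.ne', ← Real.log_rpow (by positivity), Real.exp_neg,
    Real.exp_log (by positivity), Real.rpow_natCast, ← inv_pow, inv_div]

theorem exp_neg_le_sphericalRows_real {m r : ℕ} (hr : 0 < r) {V : Entries m r}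
    (hV : ∀ i, ‖row (Matrix.of V) i‖ = 1) {ρ : ℝ} (hρ : 0 < ρ) (hρ1 : ρ ≤ 1) :
    Real.exp (-(m * r * (Real.log 4 - Real.log ρ)))
      ≤ (sphericalRows m r).real (Set.univ.pi fun i =>
        {w | ‖(WithLp.toLp 2 (V i - w) : EuclideanSpace ℝ (Fin r))‖ ≤ ρ}) := by
  have := isProbabilityMeasure_uniformSphere hr
  have h := exp_neg_sum_le_pi_real (μ := fun _ : Fin m => uniformSphere r)
    fun i => exp_neg_le_uniformSphere_real hr (hV i) hρ hρ1
  refine le_trans (le_of_eq ?_) h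
  simp [mul_assoc]

/-- The lower bound for the mass of caps needs centres on the sphere, and the last value matrix is
bounded through its unit rows. -/
theorem ae_norm_row_eq_one {m r : ℕ} (hr : 0 < r) :
    ∀ᵐ V ∂(sphericalRows m r), ∀ i, ‖row (Matrix.of V) i‖ = 1 := by
  have := isProbabilityMeasure_uniformSphere hr
  have h1 : ∀ᵐ v ∂(uniformSphere r), ‖(WithLp.toLp 2 v : EuclideanSpace ℝ (Fin r))‖ = 1 := by
    rw [uniformSphere, ae_map_iff measurable_ofLp_sphere.aemeasurable
      (measurableSet_eq_fun (by fun_prop) measurable_const)]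
    exact .of_forall fun x => by simp
  rw [ae_all_iff]
  intro i
  exact (measurePreserving_eval (fun _ : Fin m => uniformSphere r) i).quasiMeasurePreserving.ae h1

theorem integral_sum_sq_gaussianEntries (m n : ℕ) :
    Integrable (fun A : Entries m n => ∑ i, ∑ j, A i j ^ 2) (gaussianEntries m n) ∧
      ∫ A, ∑ i, ∑ j, A i j ^ 2 ∂(gaussianEntries m n) = m * n := by
  have h1 : Integrable (fun x : ℝ => x ^ 2) (gaussianReal 0 1) :=
    (memLp_id_gaussianReal 2).integrable_sq
  have h2 : ∫ x, x ^ 2 ∂(gaussianReal 0 1) = 1 := by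
    have := variance_of_integral_eq_zero (X := id) (μ := gaussianReal 0 1) aemeasurable_id
      integral_id_gaussianReal
    rw [variance_id_gaussianReal] at this
    simpa using this.symm
  have hmp : ∀ i j, MeasurePreserving (fun A : Entries m n => A i j) (gaussianEntries m n)
      (gaussianReal 0 1) := fun i j =>
    (measurePreserving_eval (fun _ : Fin n => gaussianReal 0 1) j).comp
      (measurePreserving_eval
        (fun _ : Fin m => Measure.pi fun _ : Fin n => gaussianReal 0 1) i)
  have h3 : ∀ i j, Integrable (fun A : Entries m n => A i j ^ 2) (gaussianEntries m n) :=
    fun i j => (hmp i j).integrable_comp_of_integrable h1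
  have h4 : ∀ i j, ∫ A, A i j ^ 2 ∂(gaussianEntries m n) = 1 := fun i j => by
    rw [← h2, ← (hmp i j).map_eq, integral_map (hmp i j).measurable.aemeasurable
      (by fun_prop)]
  refine ⟨integrable_finsetSum _ fun i _ => integrable_finsetSum _ fun j _ => h3 i j, ?_⟩
  rw [integral_finsetSum _ fun i _ => integrable_finsetSum _ fun j _ => h3 i j]
  simp_rw [integral_finsetSum _ fun j _ => h3 _ j, h4]
  simp

/-! ### Measurability of the network in its weights -/

theorem continuous_softmax {ι : Type*} [Fintype ι] (i : ι) :
    Continuous fun v : ι → ℝ => softmax v i := by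
  have : Nonempty ι := ⟨i⟩
  exact (Real.continuous_exp.comp (continuous_apply i)).div
    (continuous_finsetSum _ fun j _ => Real.continuous_exp.comp (continuous_apply j))
    fun v => (sum_exp_pos v).ne'

theorem continuous_clip {m n : ℕ} : Continuous (clip (m := m) (n := n)) := by
  refine continuous_matrix fun i j => ?_
  have h : ∀ i, Continuous fun M : Matrix (Fin m) (Fin n) ℝ => M i j := fun i =>
    continuous_id.matrix_elem i j
  refine (h i).div (continuous_const.max (Real.continuous_sqrt.comp
    (continuous_finsetSum _ fun i' _ => (h i').pow 2))) fun M => ?_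
  exact (lt_max_of_lt_left one_pos).ne'

theorem continuous_attention {Y : Type*} [TopologicalSpace Y] {r n : ℕ}
    {A : Y → Matrix (Fin r) (Fin r) ℝ} {U : Y → Matrix (Fin r) (Fin n) ℝ}
    (hA : Continuous A) (hU : Continuous U) : Continuous fun y => attention (A y) (U y) := by
  refine continuous_matrix fun i j => ?_
  have h : Continuous fun y => (Real.sqrt r)⁻¹ • ((U y)ᵀ * A y * U y) :=
    Continuous.const_smul ((hU.matrix_transpose.matrix_mul hA).matrix_mul hU) (Real.sqrt r)⁻¹
  exact (continuous_softmax i).comp (continuous_pi fun i' => h.matrix_elem i' j)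

theorem continuous_layer {Y : Type*} [TopologicalSpace Y] {m r n : ℕ}
    {A : Y → Matrix (Fin r) (Fin r) ℝ} {V : Y → Matrix (Fin m) (Fin r) ℝ}
    {U : Y → Matrix (Fin r) (Fin n) ℝ} (hA : Continuous A) (hV : Continuous V)
    (hU : Continuous U) : Continuous fun y => layer (A y) (V y) (U y) :=
  continuous_clip.comp ((hV.matrix_mul hU).matrix_mul (continuous_attention hA hU))

theorem continuous_foldl {Y α : Type*} [TopologicalSpace Y] [TopologicalSpace α] :
    ∀ (n : ℕ) {f : Y → α → Fin n → α}
      (_ : ∀ (l : Fin n) (u : Y → α), Continuous u → Continuous fun y => f y (u y) l)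
      {u : Y → α} (_ : Continuous u), Continuous fun y => Fin.foldl n (f y) (u y)
  | 0, f, _, u, hu => by simpa using hu
  | n + 1, f, hf, u, hu => by
    simp only [Fin.foldl_succ]
    exact continuous_foldl n (f := fun y x i => f y x i.succ) (fun l => hf l.succ) (hf 0 u hu)

theorem continuous_output {d r L n : ℕ} (U : Matrix (Fin r) (Fin n) ℝ) :
    Continuous fun θ : Weights d r L => output θ U := by
  refine continuous_layer (by exact continuous_fst.comp continuous_snd)
    (by exact continuous_snd.comp continuous_snd) ?_
  refine continuous_foldl (L - 1) (fun l u hu => ?_) continuous_const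
  have h : Continuous fun θ : Weights d r L => θ.1 l := (continuous_apply l).comp continuous_fst
  exact continuous_layer (by exact continuous_fst.comp h) (by exact continuous_snd.comp h) hu

theorem continuous_nextToken {d r L : ℕ} (K : ℕ) (Φ : Fin d → EuclideanSpace ℝ (Fin r)) (t : ℕ)
    (x : Fin (t + 1) → Fin d) (j : Fin d) :
    Continuous fun θ : Weights d r L => nextToken K Φ θ t x j :=
  (continuous_softmax j).comp (continuous_pi fun i => (continuous_output _).matrix_elem i _)

instance opensMeasurableSpace_weights (d r L : ℕ) : OpensMeasurableSpace (Weights d r L) :=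
  have : OpensMeasurableSpace (Fin (L - 1) → Entries r r × Entries r r) := inferInstance
  have : OpensMeasurableSpace (Entries r r × Entries d r) := inferInstance
  Prod.opensMeasurableSpace

theorem isPredictorFamily_nextToken {d r : ℕ} (L : ℕ) (hd : 0 < d) (K : ℕ)
    (Φ : Fin d → EuclideanSpace ℝ (Fin r)) :
    IsPredictorFamily (fun θ : Weights d r L => nextToken K Φ θ) (Real.exp (-(2 * 1)) / d) := by
  have : Nonempty (Fin d) := ⟨⟨0, hd⟩⟩
  have hd' : (0 : ℝ) < d := Nat.cast_pos.2 hd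
  refine ⟨by positivity, fun θ t x j => ?_, fun θ t x => sum_softmax _, fun t x j =>
    (continuous_nextToken K Φ t x j).measurable⟩
  have := softmax_ge (z := fun i => output θ (contextEmbedding K Φ t x) i (Fin.last _)) (b := 1)
    (fun i => abs_output_le_one θ _ i _) j
  rwa [Fintype.card_fin] at this

/-! ### Boxes of weights -/

instance isProbabilityMeasure_gaussianEntries (m n : ℕ) :
    IsProbabilityMeasure (gaussianEntries m n) := by
  rw [gaussianEntries]
  infer_instance

theorem isProbabilityMeasure_sphericalRows (m : ℕ) {r : ℕ} (hr : 0 < r) :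
    IsProbabilityMeasure (sphericalRows m r) := by
  have := isProbabilityMeasure_uniformSphere hr
  rw [sphericalRows]
  infer_instance

section Box

variable {d r L : ℕ}

theorem isProbabilityMeasure_prior (d L : ℕ) (hr : 0 < r) :
    IsProbabilityMeasure (prior d r L) := by
  have := isProbabilityMeasure_sphericalRows r hr
  have := isProbabilityMeasure_sphericalRows d hr
  rw [prior]
  infer_instance

/-- The `m × n` matrices whose entries differ from those of `A` by at most `ρ`. -/
def entryBox {m n : ℕ} (A : Entries m n) (ρ : ℝ) : Set (Entries m n) :=
  Set.univ.pi fun i => Set.univ.pi fun j => {x | |A i j - x| ≤ ρ}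

/-- The `m × n` matrices whose rows differ from those of `V` by at most `ρ` in Euclidean norm. -/
def rowBox {m n : ℕ} (V : Entries m n) (ρ : ℝ) : Set (Entries m n) :=
  Set.univ.pi fun i => {w | ‖(WithLp.toLp 2 (V i - w) : EuclideanSpace ℝ (Fin n))‖ ≤ ρ}

/-- The weights that are close to `θ`, with tolerance `ρ l` in layer `l` and `ρ'` in the last
layer. -/
def weightBox (θ : Weights d r L) (ρ : Fin (L - 1) → ℝ) (ρ' : ℝ) : Set (Weights d r L) :=
  (Set.univ.pi fun l => entryBox (θ.1 l).1 (ρ l) ×ˢ rowBox (θ.1 l).2 (ρ l)) ×ˢ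
    (entryBox θ.2.1 ρ' ×ˢ rowBox θ.2.2 ρ')

theorem measurableSet_entryBox {m n : ℕ} (A : Entries m n) (ρ : ℝ) :
    MeasurableSet (entryBox A ρ) :=
  .univ_pi fun _ => .univ_pi fun _ => measurableSet_le (by fun_prop) measurable_const

theorem measurableSet_rowBox {m n : ℕ} (V : Entries m n) (ρ : ℝ) :
    MeasurableSet (rowBox V ρ) :=
  .univ_pi fun _ => measurableSet_le (by fun_prop) measurable_const

theorem measurableSet_weightBox (θ : Weights d r L) (ρ : Fin (L - 1) → ℝ) (ρ' : ℝ) :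
    MeasurableSet (weightBox θ ρ ρ') :=
  (MeasurableSet.univ_pi fun _ => (measurableSet_entryBox _ _).prod (measurableSet_rowBox _ _)).prod
    ((measurableSet_entryBox _ _).prod (measurableSet_rowBox _ _))

/-- The rate of decay of the mass of small boxes around a Gaussian matrix. -/
def entryCost (m n : ℕ) (A : Entries m n) (x : ℝ) : ℝ :=
  m * n * (Real.log (2 * Real.pi) / 2 + 1 / 2 + x) + (∑ i, ∑ j, A i j ^ 2) / 2

/-- The box is a product of sets, one per independent matrix, so the exponents add. -/
theorem exp_neg_le_prior_weightBox (hr : 0 < r) {θ : Weights d r L}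
    (hθ : ∀ l i, ‖row (Matrix.of (θ.1 l).2) i‖ = 1) (hθ' : ∀ i, ‖row (Matrix.of θ.2.2) i‖ = 1)
    {ρ : Fin (L - 1) → ℝ} {ρ' : ℝ} (hρ : ∀ l, 0 < ρ l) (hρ1 : ∀ l, ρ l ≤ 1) (hρ' : 0 < ρ')
    (hρ1' : ρ' ≤ 1) :
    Real.exp (-(∑ l, (entryCost r r (θ.1 l).1 (-Real.log (ρ l))
        + r * r * (Real.log 4 - Real.log (ρ l)))
        + (entryCost r r θ.2.1 (-Real.log ρ') + d * r * (Real.log 4 - Real.log ρ'))))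
      ≤ (prior d r L).real (weightBox θ ρ ρ') := by
  have := isProbabilityMeasure_sphericalRows r hr
  have := isProbabilityMeasure_sphericalRows d hr
  exact exp_neg_add_le_prod_real (exp_neg_sum_le_pi_real fun l => exp_neg_add_le_prod_real
    (exp_neg_le_gaussianEntries_real _ (hρ l) (hρ1 l))
    (exp_neg_le_sphericalRows_real hr (hθ l) (hρ l) (hρ1 l)))
    (exp_neg_add_le_prod_real (exp_neg_le_gaussianEntries_real _ hρ' hρ1')
      (exp_neg_le_sphericalRows_real hr hθ' hρ' hρ1'))

/-! ### Marginals of the prior -/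

theorem measurePreserving_hidden (d : ℕ) (hr : 0 < r) (l : Fin (L - 1)) :
    MeasurePreserving (fun θ : Weights d r L => θ.1 l) (prior d r L)
      ((gaussianEntries r r).prod (sphericalRows r r)) := by
  have := isProbabilityMeasure_sphericalRows r hr
  have := isProbabilityMeasure_sphericalRows d hr
  exact (measurePreserving_eval (fun _ : Fin (L - 1) =>
    (gaussianEntries r r).prod (sphericalRows r r)) l).comp measurePreserving_fst

theorem measurePreserving_attnWeight (d : ℕ) (hr : 0 < r) (l : Fin (L - 1)) :
    MeasurePreserving (fun θ : Weights d r L => (θ.1 l).1) (prior d r L) (gaussianEntries r r) := by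
  have := isProbabilityMeasure_sphericalRows r hr
  exact measurePreserving_fst.comp (measurePreserving_hidden d hr l)

theorem measurePreserving_valueWeight (d : ℕ) (hr : 0 < r) (l : Fin (L - 1)) :
    MeasurePreserving (fun θ : Weights d r L => (θ.1 l).2) (prior d r L) (sphericalRows r r) := by
  have := isProbabilityMeasure_sphericalRows r hr
  exact measurePreserving_snd.comp (measurePreserving_hidden d hr l)

theorem measurePreserving_lastAttnWeight (d L : ℕ) (hr : 0 < r) :
    MeasurePreserving (fun θ : Weights d r L => θ.2.1) (prior d r L) (gaussianEntries r r) := by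
  have := isProbabilityMeasure_sphericalRows r hr
  have := isProbabilityMeasure_sphericalRows d hr
  exact measurePreserving_fst.comp measurePreserving_snd

theorem measurePreserving_lastValueWeight (d L : ℕ) (hr : 0 < r) :
    MeasurePreserving (fun θ : Weights d r L => θ.2.2) (prior d r L) (sphericalRows d r) := by
  have := isProbabilityMeasure_sphericalRows r hr
  have := isProbabilityMeasure_sphericalRows d hr
  exact measurePreserving_snd.comp measurePreserving_snd

theorem ae_prior_norm_row_eq_one (d L : ℕ) (hr : 0 < r) : ∀ᵐ θ ∂(prior d r L),
    (∀ l i, ‖row (Matrix.of (θ.1 l).2) i‖ = 1) ∧ ∀ i, ‖row (Matrix.of θ.2.2) i‖ = 1 := by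
  refine Filter.Eventually.and (ae_all_iff.2 fun l => ?_) ?_
  · exact (measurePreserving_valueWeight d hr l).quasiMeasurePreserving.ae (ae_norm_row_eq_one hr)
  · exact (measurePreserving_lastValueWeight d L hr).quasiMeasurePreserving.ae
      (ae_norm_row_eq_one hr)

end Box

/-! ### Functions with bounded mean -/

/-- The function `f` is integrable with integral at most `m`. -/
structure HasMeanLE {Θ : Type*} [MeasurableSpace Θ] (π : Measure Θ) (f : Θ → ℝ) (m : ℝ) : Prop where
  integrable : Integrable f π
  le : ∫ a, f a ∂π ≤ m

namespace HasMeanLE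

variable {Θ : Type*} [MeasurableSpace Θ] {π : Measure Θ} {f g : Θ → ℝ} {m m' : ℝ}

theorem add (hf : HasMeanLE π f m) (hg : HasMeanLE π g m') :
    HasMeanLE π (fun a => f a + g a) (m + m') :=
  ⟨hf.1.add hg.1, by rw [integral_add hf.1 hg.1]; exact add_le_add hf.2 hg.2⟩

theorem const [IsProbabilityMeasure π] (c : ℝ) : HasMeanLE π (fun _ => c) c :=
  ⟨integrable_const c, by simp⟩

theorem const_mul {c : ℝ} (hc : 0 ≤ c) (hf : HasMeanLE π f m) :
    HasMeanLE π (fun a => c * f a) (c * m) :=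
  ⟨hf.1.const_mul c, by rw [integral_const_mul]; exact mul_le_mul_of_nonneg_left hf.2 hc⟩

theorem sum {ι : Type*} {s : Finset ι} {f : ι → Θ → ℝ} {m : ι → ℝ}
    (hf : ∀ i, HasMeanLE π (f i) (m i)) :
    HasMeanLE π (fun a => ∑ i ∈ s, f i a) (∑ i ∈ s, m i) :=
  ⟨integrable_finsetSum _ fun i _ => (hf i).1, by
    rw [integral_finsetSum _ fun i _ => (hf i).1]
    exact Finset.sum_le_sum fun i _ => (hf i).2⟩

theorem comp {Θ' : Type*} [MeasurableSpace Θ'] {π' : Measure Θ'} {φ : Θ' → Θ}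
    (hf : HasMeanLE π f m) (hφ : MeasurePreserving φ π' π) : HasMeanLE π' (fun a => f (φ a)) m := by
  refine ⟨hφ.integrable_comp_of_integrable hf.1, le_trans (le_of_eq ?_) hf.2⟩
  rw [← hφ.map_eq, integral_map hφ.measurable.aemeasurable]
  rw [hφ.map_eq]
  exact hf.1.aestronglyMeasurable

end HasMeanLE

/-- An affine upper bound in `x²` for `log (1 + x²)`. -/
def logBound (x : ℝ) : ℝ := 1 / 16 * x ^ 2 + (Real.log 16 - 15 / 16)

theorem log_one_add_sq_le (x : ℝ) : Real.log (1 + x ^ 2) ≤ logBound x := by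
  -- The tangent of `log` at `16`, close to `1 + 66/5`, the available bound for the mean of `1 +
  -- x²`.
  have h := Real.log_le_sub_one_of_pos (x := (1 + x ^ 2) / 16) (by positivity)
  rw [Real.log_div (by positivity) (by norm_num)] at h
  rw [logBound]
  linarith

/-- The constant is `(66/5) / 16 + log 16 - 15/16`, just below `2.67`. -/
theorem hasMeanLE_logBound_valueWeight {r : ℕ} (hr : 0 < r) :
    HasMeanLE (sphericalRows r r) (fun V => logBound ‖act (Matrix.of V)‖) 2.67 := by
  have := isProbabilityMeasure_sphericalRows r hr
  obtain ⟨h1, h2⟩ := integral_norm_act_sq_sphericalRows_le hr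
  have h3 : HasMeanLE (sphericalRows r r) _ _ := ⟨h1, h2⟩
  have h4 := (h3.const_mul (c := 1 / 16) (by norm_num)).add (.const (Real.log 16 - 15 / 16))
  refine ⟨h4.1, h4.2.trans ?_⟩
  have := log_sixteen_le
  linarith

theorem hasMeanLE_logBound_attnWeight {r : ℕ} (hr : 0 < r) :
    HasMeanLE (gaussianEntries r r)
      (fun A => logBound ((Real.sqrt r)⁻¹ * ‖act (Matrix.of A)‖)) 2.67 := by
  obtain ⟨h1, h2⟩ := integral_norm_act_sq_gaussianEntries_le hr
  have h3 : HasMeanLE (gaussianEntries r r) _ _ := ⟨h1, h2⟩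
  have h4 := (h3.const_mul (c := 1 / 16) (by norm_num)).add (.const (Real.log 16 - 15 / 16))
  refine ⟨h4.1, h4.2.trans ?_⟩
  have := log_sixteen_le
  linarith

theorem hasMeanLE_entryCost {Θ : Type*} [MeasurableSpace Θ] {π : Measure Θ} [IsProbabilityMeasure π]
    {m n : ℕ} {φ : Θ → Entries m n} (hφ : MeasurePreserving φ π (gaussianEntries m n))
    {x : Θ → ℝ} {y : ℝ} (hx : HasMeanLE π x y) :
    HasMeanLE π (fun a => entryCost m n (φ a) (x a))
      (m * n * (Real.log (2 * Real.pi) / 2 + 1 / 2 + y) + m * n / 2) := by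
  obtain ⟨h1, h2⟩ := integral_sum_sq_gaussianEntries m n
  have h3 : HasMeanLE (gaussianEntries m n) _ _ := ⟨h1, h2.le⟩
  have h4 := (((HasMeanLE.const (π := π) (Real.log (2 * Real.pi) / 2 + 1 / 2)).add hx).const_mul
    (c := m * n) (by positivity)).add ((h3.const_mul (c := 1 / 2) (by norm_num)).comp hφ)
  have e : (fun a => entryCost m n (φ a) (x a)) = fun a =>
      (m : ℝ) * n * (Real.log (2 * Real.pi) / 2 + 1 / 2 + x a)
        + 1 / 2 * ∑ i, ∑ j, φ a i j ^ 2 := by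
    ext a
    rw [entryCost]
    ring
  rw [e]
  exact ⟨h4.1, h4.2.trans (le_of_eq (by ring))⟩

/-! ### Tolerances that keep the outputs of the network close -/

/-- An upper bound for the Lipschitz constant of a value matrix with operator norm `s`. -/
def lipV (s : ℝ) : ℝ := Real.sqrt (1 + s ^ 2)

/-- An upper bound for the Lipschitz constant of an attention map with normalized operator
norm `a`. -/
def lipA (a : ℝ) : ℝ := Real.sqrt (8 * (1 + a ^ 2))

theorem one_le_lipV (s : ℝ) : 1 ≤ lipV s := Real.one_le_sqrt.2 (by nlinarith [sq_nonneg s])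

theorem one_le_lipA (a : ℝ) : 1 ≤ lipA a := Real.one_le_sqrt.2 (by nlinarith [sq_nonneg a])

theorem le_lipV (s : ℝ) : s ≤ lipV s := Real.le_sqrt_of_sq_le (by linarith)

theorem one_add_two_mul_le_lipA (a : ℝ) : 1 + 2 * a ≤ lipA a :=
  Real.le_sqrt_of_sq_le (by nlinarith [sq_nonneg (a - 2), sq_nonneg a])

theorem log_lipV_le (s : ℝ) : Real.log (lipV s) ≤ 1 / 2 * logBound s := by
  rw [lipV, Real.log_sqrt (by positivity)]
  linarith [log_one_add_sq_le s]

theorem log_lipA_le (a : ℝ) : Real.log (lipA a) ≤ 1.04 + 1 / 2 * logBound a := by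
  rw [lipA, Real.log_sqrt (by positivity), Real.log_mul (by norm_num) (by positivity),
    show (8 : ℝ) = 2 ^ 3 by norm_num, Real.log_pow]
  have := Real.log_two_lt_d9
  push_cast
  linarith [log_one_add_sq_le a]

section Tolerance

variable {d r L : ℕ}

/-- The operator norm of a hidden value matrix. -/
def valueNorm (θ : Weights d r L) (l : Fin (L - 1)) : ℝ := ‖act (Matrix.of (θ.1 l).2)‖

/-- The normalized operator norm of a hidden attention matrix. -/
def attnNorm (θ : Weights d r L) (l : Fin (L - 1)) : ℝ :=
  (Real.sqrt r)⁻¹ * ‖act (Matrix.of (θ.1 l).1)‖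

/-- The normalized operator norm of the last attention matrix. -/
def lastAttnNorm (θ : Weights d r L) : ℝ := (Real.sqrt r)⁻¹ * ‖act (Matrix.of θ.2.1)‖

/-- An upper bound for the Lipschitz constant of the layers with index at least `i`. -/
def tailLip (θ : Weights d r L) (i : ℕ) : ℝ :=
  (∏ k ∈ Finset.univ.filter (fun k : Fin (L - 1) => i ≤ k.val),
    lipV (valueNorm θ k) * lipA (attnNorm θ k)) * (Real.sqrt d * lipA (lastAttnNorm θ))

/-- The tolerance for the weights of a hidden layer. -/
def tol (c : ℝ) (θ : Weights d r L) (l : Fin (L - 1)) : ℝ :=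
  c / (2 * Real.sqrt r * lipV (valueNorm θ l) * tailLip θ (l.val + 1))

/-- The tolerance for the weights of the last layer. -/
def lastTol (d r : ℕ) (c : ℝ) : ℝ := c / (2 * Real.sqrt r * Real.sqrt d)

/-- This is the recursion that `foldl_dist_le` requires of its weights `R`. -/
theorem tailLip_castSucc (θ : Weights d r L) (l : Fin (L - 1)) :
    tailLip θ l.val = lipV (valueNorm θ l) * lipA (attnNorm θ l) * tailLip θ (l.val + 1) := by
  have e : Finset.univ.filter (fun k : Fin (L - 1) => l.val ≤ k.val)
      = insert l (Finset.univ.filter (fun k : Fin (L - 1) => l.val + 1 ≤ k.val)) := by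
    ext k
    simp only [Finset.mem_filter, Finset.mem_univ, true_and, Finset.mem_insert, Fin.ext_iff]
    omega
  rw [tailLip, e, Finset.prod_insert (by simp), tailLip]
  ring

theorem tailLip_last (θ : Weights d r L) :
    tailLip θ (L - 1) = Real.sqrt d * lipA (lastAttnNorm θ) := by
  have e : Finset.univ.filter (fun k : Fin (L - 1) => L - 1 ≤ k.val) = ∅ := by
    ext k
    simp only [Finset.mem_filter, Finset.mem_univ, true_and, Finset.notMem_empty, iff_false,
      not_le]
    exact k.isLt
  rw [tailLip, e, Finset.prod_empty, one_mul]

theorem one_le_sqrt_natCast {n : ℕ} (hn : 0 < n) : 1 ≤ Real.sqrt n :=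
  Real.one_le_sqrt.2 (Nat.one_le_cast.2 hn)

theorem one_le_tailLip (hd : 0 < d) (θ : Weights d r L) (i : ℕ) : 1 ≤ tailLip θ i :=
  one_le_mul_of_one_le_of_one_le
    (Finset.prod_induction _ (fun x => 1 ≤ x) (fun _ _ => one_le_mul_of_one_le_of_one_le)
      le_rfl fun _ _ => one_le_mul_of_one_le_of_one_le (one_le_lipV _) (one_le_lipA _))
    (one_le_mul_of_one_le_of_one_le (one_le_sqrt_natCast hd) (one_le_lipA _))

theorem tol_pos (hd : 0 < d) (hr : 0 < r) {c : ℝ} (hc : 0 < c) (θ : Weights d r L) (l) :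
    0 < tol c θ l := by
  have h1 := one_le_tailLip hd θ (l.val + 1)
  have h2 := one_le_lipV (valueNorm θ l)
  have h3 := one_le_sqrt_natCast hr
  exact div_pos hc (by positivity)

theorem tol_le_one (hd : 0 < d) (hr : 0 < r) {c : ℝ} (hc1 : c ≤ 1)
    (θ : Weights d r L) (l) : tol c θ l ≤ 1 := by
  have h1 := one_le_tailLip hd θ (l.val + 1)
  have h2 := one_le_lipV (valueNorm θ l)
  have h3 := one_le_sqrt_natCast hr
  refine div_le_one_of_le₀ (hc1.trans ?_) (by positivity)
  exact one_le_mul_of_one_le_of_one_le (one_le_mul_of_one_le_of_one_le (by linarith) h2) h1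

theorem lastTol_pos (hd : 0 < d) (hr : 0 < r) {c : ℝ} (hc : 0 < c) : 0 < lastTol d r c := by
  have h1 := one_le_sqrt_natCast hd
  have h3 := one_le_sqrt_natCast hr
  exact div_pos hc (by positivity)

theorem lastTol_le_one (hd : 0 < d) (hr : 0 < r) {c : ℝ} (hc1 : c ≤ 1) : lastTol d r c ≤ 1 := by
  have h1 := one_le_sqrt_natCast hd
  have h3 := one_le_sqrt_natCast hr
  refine div_le_one_of_le₀ (hc1.trans ?_) (by positivity)
  exact one_le_mul_of_one_le_of_one_le (by linarith) h1

/-- The tolerances are designed so that each of the `L - 1` hidden layers and the last one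
contributes at most `c`. Since `lipV` is at least one, `v √r + √r ≤ 2 √r v`, which accounts for the
`2 √r` in `tol`. -/
theorem abs_output_sub_le_of_mem_weightBox (hd : 0 < d) (hr : 0 < r) (hL : 0 < L) {c : ℝ}
    (hc : 0 < c) {θ θ' : Weights d r L} (hθ : ∀ i, ‖row (Matrix.of θ.2.2) i‖ = 1)
    (hθ' : θ' ∈ weightBox θ (tol c θ) (lastTol d r c)) {n : ℕ} {U : Matrix (Fin r) (Fin n) ℝ}
    (hU : ∀ j, ‖col U j‖ ≤ 1) (i : Fin d) (j : Fin n) :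
    |output θ U i j - output θ' U i j| ≤ L * c := by
  have hsd := one_le_sqrt_natCast hd
  have hsr := one_le_sqrt_natCast hr
  obtain ⟨h1, h2, h3⟩ := hθ'
  have hvlast : ‖act (Matrix.of θ.2.2)‖ ≤ Real.sqrt d := by
    simpa using norm_act_le_of_row_le zero_le_one fun i => (hθ i).le
  have key := abs_output_sub_le (θ := θ) (θ' := θ') hU (c := c)
    (v := fun l => lipV (valueNorm θ l)) (b := fun l => lipA (attnNorm θ l)) (ρ := tol c θ)
    (v' := Real.sqrt d) (b' := lipA (lastAttnNorm θ)) (ρ' := lastTol d r c)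
    (R := fun l => tailLip θ l.val)
    (fun l => zero_le_one.trans (one_le_tailLip hd θ _))
    (fun l => le_lipV _) (fun l => one_add_two_mul_le_lipA _) (fun l => (tol_pos hd hr hc θ l).le)
    (fun l i j => (h1 l trivial).1 i trivial j trivial) (fun l i => (h1 l trivial).2 i trivial)
    hvlast (one_add_two_mul_le_lipA _) (lastTol_pos hd hr hc).le
    (fun i j => h2 i trivial j trivial) (fun i => h3 i trivial)
    (tailLip_last θ) (fun l => tailLip_castSucc θ l) (fun l => ?_) i j
  · refine key.trans ?_
    have h4 : (Real.sqrt d * Real.sqrt r + Real.sqrt d) * lastTol d r c ≤ c := by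
      rw [lastTol, mul_div_assoc', div_le_iff₀ (by positivity), mul_comm c]
      refine mul_le_mul_of_nonneg_right ?_ hc.le
      nlinarith
    have h5 : ((L - 1 : ℕ) : ℝ) = L - 1 := by rw [Nat.cast_sub hL, Nat.cast_one]
    rw [h5]
    linarith
  · have h6 := one_le_tailLip hd θ (l.val + 1)
    have h7 := one_le_lipV (valueNorm θ l)
    rw [Fin.val_succ, tol, mul_div_assoc', div_mul_eq_mul_div, div_le_iff₀ (by positivity)]
    have h8 : lipV (valueNorm θ l) * Real.sqrt r + Real.sqrt r
        ≤ 2 * Real.sqrt r * lipV (valueNorm θ l) := by nlinarith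
    have := mul_le_mul_of_nonneg_right h8 (by positivity : 0 ≤ c * tailLip θ (l.val + 1))
    linarith

/-- An upper bound for the negative logarithm of the tolerance in a hidden layer. -/
def tolBound (C : ℝ) (θ : Weights d r L) (l : Fin (L - 1)) : ℝ :=
  C + 1 / 2 * logBound (valueNorm θ l) + ((1.04 + 1 / 2 * logBound (lastAttnNorm θ)) +
    ∑ k ∈ Finset.univ.filter (fun k : Fin (L - 1) => l.val + 1 ≤ k.val),
      (1 / 2 * logBound (valueNorm θ k) + (1.04 + 1 / 2 * logBound (attnNorm θ k))))

theorem neg_log_lastTol (hd : 0 < d) (hr : 0 < r) {c : ℝ} (hc : 0 < c) :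
    -Real.log (lastTol d r c)
      = -Real.log c + Real.log 2 + 1 / 2 * Real.log r + 1 / 2 * Real.log d := by
  have h1 := one_le_sqrt_natCast hd
  have h3 := one_le_sqrt_natCast hr
  rw [lastTol, Real.log_div hc.ne' (by positivity), Real.log_mul (by positivity) (by positivity),
    Real.log_mul (by positivity) (by positivity), Real.log_sqrt (by positivity),
    Real.log_sqrt (by positivity)]
  ring

/-- The logarithm turns the product of Lipschitz constants into a sum whose terms are affine in
squared operator norms and can be averaged under the prior. -/
theorem neg_log_tol_le (hd : 0 < d) (hr : 0 < r) {c : ℝ} (hc : 0 < c) (θ : Weights d r L) (l) :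
    -Real.log (tol c θ l) ≤ tolBound (-Real.log (lastTol d r c)) θ l := by
  have hsd := one_le_sqrt_natCast hd
  have hsr := one_le_sqrt_natCast hr
  have h1 := one_le_tailLip hd θ (l.val + 1)
  have h2 := one_le_lipV (valueNorm θ l)
  have h3 : Real.log (tailLip θ (l.val + 1)) = ∑ k ∈ Finset.univ.filter
      (fun k : Fin (L - 1) => l.val + 1 ≤ k.val),
        (Real.log (lipV (valueNorm θ k)) + Real.log (lipA (attnNorm θ k)))
      + (1 / 2 * Real.log d + Real.log (lipA (lastAttnNorm θ))) := by
    have hA := fun a => (zero_lt_one.trans_le (one_le_lipA a)).ne'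
    have hV := fun a => (zero_lt_one.trans_le (one_le_lipV a)).ne'
    rw [tailLip, Real.log_mul (Finset.prod_ne_zero_iff.2 fun k _ => mul_ne_zero (hV _) (hA _))
      (mul_ne_zero (by positivity) (hA _)), Real.log_prod fun k _ => mul_ne_zero (hV _) (hA _),
      Real.log_mul (by positivity) (hA _), Real.log_sqrt (by positivity)]
    congr 1
    · exact Finset.sum_congr rfl fun k _ => Real.log_mul (hV _) (hA _)
    · ring
  have h4 := Finset.sum_le_sum fun k (_ : k ∈ Finset.univ.filter
    (fun k : Fin (L - 1) => l.val + 1 ≤ k.val)) =>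
      add_le_add (log_lipV_le (valueNorm θ k)) (log_lipA_le (attnNorm θ k))
  have h5 := log_lipA_le (lastAttnNorm θ)
  have h6 := log_lipV_le (valueNorm θ l)
  rw [tol, Real.log_div hc.ne' (by positivity), Real.log_mul (by positivity) (by positivity),
    Real.log_mul (by positivity) (by positivity), Real.log_mul (by positivity) (by positivity),
    h3, Real.log_sqrt (by positivity), tolBound, neg_log_lastTol hd hr hc]
  linarith

/-- Here `1.335 = 2.67 / 2` and `2.375 = 1.04 + 1.335`, so a later hidden layer costs `3.71`; the
attention map of the last layer is absorbed by counting one layer more. -/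
theorem hasMeanLE_tolBound (d : ℕ) (hr : 0 < r) (C : ℝ) (l : Fin (L - 1)) :
    HasMeanLE (prior d r L) (fun θ => tolBound C θ l)
      (C + 1.335 + 3.71 * (((L - 1 : ℕ) : ℝ) - l.val)) := by
  have := isProbabilityMeasure_prior d L hr
  have hv : ∀ k, HasMeanLE (prior d r L) (fun θ => 1 / 2 * logBound (valueNorm θ k)) 1.335 :=
    fun k => by
      have := ((hasMeanLE_logBound_valueWeight hr).comp
        (measurePreserving_valueWeight d hr k)).const_mul (c := 1 / 2) (by norm_num)
      exact ⟨this.1, this.2.trans (by norm_num)⟩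
  have ha : ∀ k, HasMeanLE (prior d r L) (fun θ => 1.04 + 1 / 2 * logBound (attnNorm θ k)) 2.375 :=
    fun k => by
      have := (HasMeanLE.const 1.04).add (((hasMeanLE_logBound_attnWeight hr).comp
        (measurePreserving_attnWeight d hr k)).const_mul (c := 1 / 2) (by norm_num))
      exact ⟨this.1, this.2.trans (by norm_num)⟩
  have ha' : HasMeanLE (prior d r L) (fun θ => 1.04 + 1 / 2 * logBound (lastAttnNorm θ)) 2.375 := by
    have := (HasMeanLE.const 1.04).add (((hasMeanLE_logBound_attnWeight hr).comp
      (measurePreserving_lastAttnWeight d L hr)).const_mul (c := 1 / 2) (by norm_num))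
    exact ⟨this.1, this.2.trans (by norm_num)⟩
  have h := ((HasMeanLE.const C).add (hv l)).add (ha'.add (.sum
    (s := Finset.univ.filter (fun k : Fin (L - 1) => l.val + 1 ≤ k.val))
    fun k => (hv k).add (ha k)))
  refine ⟨h.1, h.2.trans ?_⟩
  have hcard : ((Finset.univ.filter (fun k : Fin (L - 1) => l.val + 1 ≤ k.val)).card : ℝ) + 1
      = ((L - 1 : ℕ) : ℝ) - l.val := by
    have e : Finset.univ.filter (fun k : Fin (L - 1) => l.val + 1 ≤ k.val) = Finset.Ioi l := by
      ext k
      simp only [Finset.mem_filter, Finset.mem_univ, true_and, Finset.mem_Ioi, Fin.lt_def,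
        Nat.succ_le_iff]
    have hl := l.isLt
    rw [e, Fin.card_Ioi, eq_sub_iff_add_eq]
    norm_cast
    omega
  rw [Finset.sum_const, nsmul_eq_mul, ← hcard]
  linarith

end Tolerance

theorem sum_fin_sub (n : ℕ) : ∑ l : Fin n, ((n : ℝ) - l.val) = n * (n + 1) / 2 := by
  rw [Fin.sum_univ_eq_sum_range (fun i => (n : ℝ) - i)]
  induction n with
  | zero => simp
  | succ n ih =>
    rw [Finset.sum_range_succ]
    have : ∀ i ∈ Finset.range n, ((n + 1 : ℕ) : ℝ) - i = ((n : ℝ) - i) + 1 := fun i _ => by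
      push_cast; ring
    rw [Finset.sum_congr rfl this, Finset.sum_add_distrib, ih]
    simp
    ring

/-! ### The cost of a box of weights -/

section Cost

variable {d r L : ℕ}

/-- An upper bound for the negative logarithm of the prior mass of the box of tolerances around
`θ`. -/
def boxCost (C : ℝ) (θ : Weights d r L) : ℝ :=
  ∑ l, (entryCost r r (θ.1 l).1 (tolBound C θ l) + r * r * (Real.log 4 + tolBound C θ l))
    + (entryCost r r θ.2.1 C + d * r * (Real.log 4 + C))

/-- The cost of a box increases with the negative logarithms of its tolerances, so these may be
replaced by their bounds. -/
theorem exp_neg_boxCost_le (hd : 0 < d) (hr : 0 < r) {c : ℝ} (hc : 0 < c) (hc1 : c ≤ 1)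
    {θ : Weights d r L} (hθ : ∀ l i, ‖row (Matrix.of (θ.1 l).2) i‖ = 1)
    (hθ' : ∀ i, ‖row (Matrix.of θ.2.2) i‖ = 1) :
    Real.exp (-boxCost (-Real.log (lastTol d r c)) θ)
      ≤ (prior d r L).real (weightBox θ (tol c θ) (lastTol d r c)) := by
  refine le_trans (Real.exp_le_exp.2 (neg_le_neg ?_)) (exp_neg_le_prior_weightBox hr hθ hθ'
    (tol_pos hd hr hc θ) (tol_le_one hd hr hc1 θ) (lastTol_pos hd hr hc) (lastTol_le_one hd hr hc1))
  rw [boxCost]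
  simp only [sub_eq_add_neg (Real.log 4), entryCost]
  gcongr
  · exact neg_log_tol_le hd hr hc θ _
  · exact neg_log_tol_le hd hr hc θ _

theorem hasMeanLE_boxCost (hr : 0 < r) (hL : 0 < L) {C : ℝ} (hC : 0 ≤ C) :
    HasMeanLE (prior d r L) (boxCost C)
      (r * (max r d : ℕ) * (L * (3.43 + 2 * C) + 2.67 * (L - 1) + 3.71 * (L * (L - 1)))) := by
  have := isProbabilityMeasure_prior d L hr
  have h := (HasMeanLE.sum (s := Finset.univ) fun l : Fin (L - 1) =>
      (hasMeanLE_entryCost (measurePreserving_attnWeight d hr l)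
        (hasMeanLE_tolBound d hr C l)).add
        (((HasMeanLE.const (Real.log 4)).add (hasMeanLE_tolBound d hr C l)).const_mul
          (c := r * r) (by positivity))).add
    ((hasMeanLE_entryCost (measurePreserving_lastAttnWeight d L hr) (.const C)).add
      ((HasMeanLE.const (Real.log 4 + C)).const_mul (c := d * r) (by positivity)))
  refine ⟨h.1, h.2.trans ?_⟩
  have hlog2 := Real.log_two_lt_d9
  have hlog4 : Real.log 4 ≤ 1.3863 := by
    rw [show (4 : ℝ) = 2 ^ 2 by norm_num, Real.log_pow]
    push_cast
    linarith
  have hpi : Real.log (2 * Real.pi) ≤ 2.0795 := by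
    have : Real.log (2 * Real.pi) ≤ Real.log (2 ^ 3) :=
      Real.log_le_log (by positivity) (by linarith [Real.pi_lt_four])
    rw [Real.log_pow] at this
    push_cast at this
    linarith
  set G := Real.log (2 * Real.pi) / 2 + 1 / 2 with hG
  have hG1 : G ≤ 1.54 := by rw [hG]; linarith
  set n : ℝ := ((L - 1 : ℕ) : ℝ) with hn
  have hn' : n = L - 1 := by rw [hn, Nat.cast_sub hL, Nat.cast_one]
  have hn0 : 0 ≤ n := Nat.cast_nonneg _
  set M : ℝ := ((max r d : ℕ) : ℝ) with hM
  have hrM : (r : ℝ) ≤ M := Nat.cast_le.2 (le_max_left r d)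
  have hdM : (d : ℝ) ≤ M := Nat.cast_le.2 (le_max_right r d)
  have hr0 : (0 : ℝ) ≤ r := Nat.cast_nonneg _
  have hlog4' : 0 ≤ Real.log 4 := Real.log_nonneg (by norm_num)
  have e : ∀ l : Fin (L - 1), (r : ℝ) * r * (G + (C + 1.335 + 3.71 * (n - l.val))) + r * r / 2
      + r * r * (Real.log 4 + (C + 1.335 + 3.71 * (n - l.val)))
      = r * r * (G + 1 / 2 + Real.log 4 + 2 * C + 2.67) + r * r * 7.42 * (n - l.val) := fun l => by
    ring
  -- Summing the number of remaining layers over all hidden layers produces the term quadratic in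
  -- the depth.
  rw [Finset.sum_congr rfl fun l _ => e l, Finset.sum_add_distrib, Finset.sum_const,
    Finset.card_univ, Fintype.card_fin, nsmul_eq_mul, ← Finset.mul_sum, sum_fin_sub]
  have hL' : (L : ℝ) = n + 1 := by rw [hn']; ring
  have hrr : (r : ℝ) * r ≤ r * M := mul_le_mul_of_nonneg_left hrM hr0
  have hdr : (d : ℝ) * r ≤ r * M := by rw [mul_comm]; exact mul_le_mul_of_nonneg_left hdM hr0
  have b1 : (r : ℝ) * r * (n * (G + 1 / 2 + Real.log 4 + 2 * C + 2.67) + 3.71 * (n * (n + 1))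
      + (G + C + 1 / 2)) ≤ r * M * (n * (1.54 + 1 / 2 + 1.3863 + 2 * C + 2.67)
      + 3.71 * (n * (n + 1)) + (1.54 + C + 1 / 2)) := by
    have hpi0 : 0 ≤ G := by
      have := Real.log_nonneg (x := 2 * Real.pi) (by linarith [Real.pi_gt_three])
      rw [hG]; linarith
    gcongr
  have b2 : (d : ℝ) * r * (Real.log 4 + C) ≤ r * M * (1.3863 + C) := by gcongr
  have b3 : 0 ≤ (r : ℝ) * M * n := by positivity
  have b4 : 0 ≤ (r : ℝ) * M := by positivity
  rw [hL', ← hn]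
  -- `0.0037` is the rounding gap `3.43 - (1.54 + 1/2 + 1.3863)`.
  linear_combination b1 + b2 + 0.0037 * b3 + 0.0037 * b4

end Cost

/-! ### Numerical estimates -/

theorem le_log_eight_mul_exp_mul {K : ℝ} (hK : 1 ≤ K) :
    5.85 ≤ Real.log (8 * Real.exp 1 * K * (1 + 16 * K)) := by
  -- For `K ≥ 1` the argument is at least `2^7 e`, and `1 + 7 log 2 > 5.85`.
  have h1 : Real.exp 1 * 2 ^ 7 ≤ 8 * Real.exp 1 * K * (1 + 16 * K) := by
    have h : (16 : ℝ) ≤ K * (1 + 16 * K) := by nlinarith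
    have := mul_le_mul_of_nonneg_left h (by positivity : 0 ≤ 8 * Real.exp 1)
    linarith
  have h2 := Real.log_le_log (by positivity) h1
  rw [Real.log_mul (Real.exp_pos 1).ne' (by norm_num), Real.log_exp, Real.log_pow] at h2
  push_cast at h2
  linarith [Real.log_two_gt_d9]

theorem le_log_two_mul_mul_sq_div {K T L : ℝ} (hK : 1 ≤ K) (hT : 0 < T) (hL : 0 < L) :
    Real.log 2 + 2 * Real.log T - Real.log L ≤ Real.log (2 * K * T ^ 2 / L) := by
  rw [Real.log_div (by positivity) hL.ne', Real.log_mul (by positivity) (by positivity),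
    Real.log_mul (by norm_num) (by positivity), Real.log_pow]
  push_cast
  linarith [Real.log_nonneg hK]

/-- The bound for horizons that are shorter than the number of parameters. -/
theorem four_mul_le_of_lt {r M L T a b : ℝ} (hr : 0 ≤ r) (hM : 0 ≤ M) (hL : 1 ≤ L) (hT : 1 ≤ T)
    (hTB : T ≤ r * M * L) (ha : 5.85 ≤ a)
    (hb : Real.log 2 + 2 * Real.log T - Real.log L ≤ b) :
    T * 4 ≤ r * M * L ^ 2 * a + r * M * L * b := by
  have h1 := Real.log_le_sub_one_of_pos (by linarith : 0 < L)
  -- The possibly negative `-log L` in `b` is at least `1 - L`, which `5.85 L` absorbs.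
  have h2 : 4 ≤ L * a + b := by nlinarith [Real.log_two_gt_d9, Real.log_nonneg hT]
  have := mul_le_mul_of_nonneg_left h2 (by positivity : 0 ≤ r * M * L)
  linarith

/-- The bound for horizons that are longer than the number of parameters. -/
theorem cost_add_le_of_le {r M L T C a b : ℝ} (hr : 1 ≤ r) (hM : 1 ≤ M) (hL : 1 ≤ L)
    (hTB : r * M * L ≤ T) (ha : 5.85 ≤ a) (hb : Real.log 2 + 2 * Real.log T - Real.log L ≤ b)
    (hC : 2 * C ≤ 2 * Real.log 2 + Real.log L + Real.log T) :
    r * M * (L * (3.43 + 2 * C) + 2.67 * (L - 1) + 3.71 * (L * (L - 1))) + r * M * L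
      ≤ r * M * L ^ 2 * a + r * M * L * b := by
  have hL0 : 0 < L := by linarith
  have h1 := Real.log_le_sub_one_of_pos hL0
  have hrM : 1 ≤ r * M := one_le_mul_of_one_le_of_one_le hr hM
  have h2 : Real.log L ≤ Real.log T :=
    Real.log_le_log hL0 ((le_mul_of_one_le_left hL0.le hrM).trans hTB)
  have h3 : L * (3.43 + 2 * C) + L ≤ L * (b + L + 4.13) := by
    -- `2 C - b ≤ log 2 + 2 log L - log T ≤ log 2 + log L ≤ log 2 + L - 1`, using `L ≤ T`.
    have : 3.43 + 2 * C + 1 ≤ b + L + 4.13 := by linarith [Real.log_two_lt_d9]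
    linarith [mul_le_mul_of_nonneg_left this hL0.le]
  have h4 : L * (3.43 + 2 * C) + 2.67 * (L - 1) + 3.71 * (L * (L - 1)) + L
      ≤ L ^ 2 * a + L * b := by
    -- What remains is `1.14 L² - 3.09 L + 2.67 ≥ 0`, whose minimum is near `1.355`.
    nlinarith [sq_nonneg (L - 1.355), mul_le_mul_of_nonneg_left ha (sq_nonneg L)]
  have := mul_le_mul_of_nonneg_left h4 (by linarith : 0 ≤ r * M)
  linarith

/-- The logarithmic cost of the last tolerance when it corresponds to the error `√(B / T)`, where
`B = r * max r d * L`. -/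
theorem two_mul_neg_log_lastTol_le {d r L : ℕ} (hd : 0 < d) (hr : 0 < r) (hL : 0 < L) {T : ℝ}
    (hT : 0 < T) :
    2 * -Real.log (lastTol d r (Real.sqrt (r * (max r d : ℕ) * L / T) / L))
      ≤ 2 * Real.log 2 + Real.log L + Real.log T := by
  have hd' : (0 : ℝ) < d := Nat.cast_pos.2 hd
  have hr' : (0 : ℝ) < r := Nat.cast_pos.2 hr
  have hL' : (0 : ℝ) < L := Nat.cast_pos.2 hL
  have hM : (0 : ℝ) < (max r d : ℕ) := Nat.cast_pos.2 (lt_max_of_lt_left hr)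
  -- The `r` of `B` cancels the `√r` of the tolerance, and `max r d` dominates the `√d`.
  have hdM : Real.log d ≤ Real.log (max r d : ℕ) :=
    Real.log_le_log hd' (Nat.cast_le.2 (le_max_right r d))
  rw [neg_log_lastTol hd hr (by positivity), Real.log_div (by positivity) hL'.ne',
    Real.log_sqrt (by positivity), Real.log_div (by positivity) hT.ne',
    Real.log_mul (by positivity) hL'.ne', Real.log_mul hr'.ne' hM.ne']
  linarith

end TransformerProcess

end

/-! ### The main theorem -/

theorem mainTheorem7 {Ω : Type*} [MeasurableSpace Ω] (P : Measure Ω) [IsProbabilityMeasure P]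
    (d r L K T : ℕ) (hd : 0 < d) (hr : 0 < r) (hL : 0 < L) (hK : 0 < K) (hT : 0 < T)
    (Φ : Fin d → EuclideanSpace ℝ (Fin r)) (hΦ : ∀ j, ‖Φ j‖ = 1)
    (θ : Ω → TransformerProcess.Weights d r L) (X : ℕ → Ω → Fin d)
    (hX : TransformerProcess.IsTransformerProcess K Φ θ X P) :
    TransformerProcess.estimationError P θ X T ≤
      (r : ℝ) * (max r d : ℕ) * (L : ℝ) ^ 2 * Real.log (8 * Real.exp 1 * K * (1 + 16 * K)) / T
        + (r : ℝ) * (max r d : ℕ) * L * Real.log (2 * K * (T : ℝ) ^ 2 / L) / T := by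
  open TransformerProcess in
  have := isProbabilityMeasure_prior d L hr
  have : Nonempty (Fin d) := ⟨⟨0, hd⟩⟩
  have hr1 : (1 : ℝ) ≤ r := Nat.one_le_cast.2 hr
  have hL1 : (1 : ℝ) ≤ L := Nat.one_le_cast.2 hL
  have hK1 : (1 : ℝ) ≤ K := Nat.one_le_cast.2 hK
  have hT1 : (1 : ℝ) ≤ T := Nat.one_le_cast.2 hT
  have hT0 : (0 : ℝ) < T := zero_lt_one.trans_le hT1
  have hM1 : (1 : ℝ) ≤ (max r d : ℕ) := Nat.one_le_cast.2 (lt_max_of_lt_left hr)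
  have ha := le_log_eight_mul_exp_mul hK1
  have hb := le_log_two_mul_mul_sq_div hK1 hT0 (zero_lt_one.trans_le hL1)
  have key := fun {δ} {N} {g} => estimationError_le (δ := δ) (N := N) (g := g)
    hX.measurable_weights hX.measurable_token hX.map_weights hX.indep_first hX.next_token
    (isPredictorFamily_nextToken L hd K Φ) T
  rw [← add_div]
  rcases lt_or_ge (T : ℝ) (r * (max r d : ℕ) * L) with hTB | hTB
  -- Short horizon: the whole parameter space costs nothing, and logits in `[-1, 1]` differ by at
  -- most `2`, so each step costs at most `2 * 2`.
  · refine (key (δ := 4) (N := fun _ => Set.univ) (g := fun _ => 0) (fun _ => .univ)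
      (.of_forall fun _ => by simp) (.of_forall fun _ => by simp) (integrable_const 0)
      (.of_forall fun a b _ t h => ?_)).trans ?_
    · refine (sum_softmax_mul_log_sub_le (ε := 2) fun i => ?_).trans (by norm_num)
      refine (abs_sub _ _).trans ?_
      linarith [abs_output_le_one a (contextEmbedding K Φ t h) i (Fin.last _),
        abs_output_le_one b (contextEmbedding K Φ t h) i (Fin.last _)]
    · rw [integral_zero, zero_add]
      exact div_le_div_of_nonneg_right (four_mul_le_of_lt (by linarith) (by linarith) hL1 hT1
        hTB.le ha hb) hT0.le
  · set B : ℝ := r * (max r d : ℕ) * L with hB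
    have hB0 : 0 < B := by positivity
    have hBT : B / T ≤ 1 := div_le_one_of_le₀ hTB hT0.le
    -- Total logit error `√(B / T) ≤ 1`, split evenly over the layers, so that the relative entropy
    -- over `T` steps is at most `B`.
    set c : ℝ := Real.sqrt (B / T) / L with hc
    have hε : Real.sqrt (B / T) ≤ 1 := Real.sqrt_le_one.2 hBT
    have hc0 : 0 < c := by positivity
    have hc1 : c ≤ 1 := div_le_one_of_le₀ (hε.trans hL1) (by linarith)
    have hLc : L * c = Real.sqrt (B / T) := mul_div_cancel₀ _ (by positivity)
    have hC : 0 ≤ -Real.log (lastTol d r c) :=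
      neg_nonneg.2 (Real.log_nonpos (lastTol_pos hd hr hc0).le (lastTol_le_one hd hr hc1))
    have hmean := hasMeanLE_boxCost (d := d) hr hL hC
    have hrows := ae_prior_norm_row_eq_one d L hr
    refine (key (δ := B / T) (N := fun a => weightBox a (tol c a) (lastTol d r c))
      (g := boxCost (-Real.log (lastTol d r c))) (fun a => measurableSet_weightBox _ _ _)
      ?_ ?_ hmean.integrable ?_).trans ?_
    · filter_upwards [hrows] with a h
      exact (Real.exp_pos _).trans_le (exp_neg_boxCost_le hd hr hc0 hc1 h.1 h.2)
    · filter_upwards [hrows] with a h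
      have := Real.log_le_log (Real.exp_pos _) (exp_neg_boxCost_le hd hr hc0 hc1 h.1 h.2)
      rw [Real.log_exp] at this
      linarith
    · filter_upwards [hrows] with a h b hb t x
      have := sum_softmax_mul_log_sub_le_sq hε fun i =>
        (abs_output_sub_le_of_mem_weightBox hd hr hL hc0 h.2 hb
          (norm_col_contextEmbedding K hΦ t x) i (Fin.last _)).trans hLc.le
      rwa [Real.sq_sqrt (by positivity)] at this
    · refine div_le_div_of_nonneg_right ?_ hT0.le
      rw [mul_div_cancel₀ _ hT0.ne']
      exact (add_le_add_left hmean.le B).trans (cost_add_le_of_le hr1 hM1 hL1 hTB ha hb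
        (two_mul_neg_log_lastTol_le hd hr hL hT0))
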